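/- Let $\square_+$ be the category whose objects are the posets $\mathbb I^n=\{0,1\}^n$ ($n\ge 0$, product order) and whose morphisms are the maps that are composites of the maps $\delta_i^{n,\varepsilon}:\mathbb I^{n-1}\to\mathbb I^{n}$, $(x_1,\dots,x_{n-1})\mapsto(x_1,\dots,x_{i-1},\varepsilon,x_i,\dots,x_{n-1})$, $1\le i\le n$, $\varepsilon\in\{0,1\}$. A precubical set is a functor $X:\square_+^{op}\to\mathrm{Set}$; write $X_n=X(\mathbb I^n)$ and $\sigma\delta=X(\delta)(\sigma)$. The category $\square_+/X$ has the elements of $\coprod_n X_n$ as objects, and its morphisms $\sigma\to\tau$ ($\sigma\in X_m$, $\tau\in X_n$) are the morphisms $\alpha:\mathbb I^m\to\mathbb I^n$ of $\square_+$ with $X(\alpha)(\tau)=\sigma$. A homological system on $X$ is a functor $F:(\square_+/X)^{op}\to\mathrm{Ab}$. Let $H_n(X,F)$ be the $n$-th homology group of the chain complex $C_n(X,F)=\bigoplus_{\sigma\in X_n}F(\sigma)$, $n\ge 0$, with differential $d_n=\sum_{i=1}^n(-1)^i(d_i^{n,1}-d_i^{n,0})$, where $d_i^{n,\varepsilon}$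 maps the summand $F(\sigma)$ to the summand $F(\sigma\delta_i^{n,\varepsilon})$ by $F(\delta_i^{n,\varepsilon}:\sigma\delta_i^{n,\varepsilon}\to\sigma)$. For a small category $\mathcal C$ and a functor $F:\mathcal C\to\mathrm{Ab}$ let $\varinjlim_n^{\mathcal C}F$ be the $n$-th homology group of the chain complex $C_n(\mathcal C,F)=\bigoplus_{c_0\to\cdots\to c_n}F(c_0)$, $n\ge0$, with differential $\sum_{i=0}^n(-1)^i d_i^n$, where $d_i^n$ omits $c_i$, acting on coefficients as the identity of $F(c_0)$ for $i\ge1$ and as $F(c_0\to c_1)$ for $i=0$. (These are the values of the left derived functors of the colimit.) Let $\mathcal{HS}$ be the category of pairs $(X,F)$ of a precubical set $X$ and a homological system $F$ on $X$, in which a morphism $(X,F)\to(Y,G)$ is a morphism (natural transformation) $f:X\to Y$ with $G\circ(\square_+/f)^{op}=F$, where $\square_+/f$ sends $\sigma$ to $f(\sigma)$. Such an $f$ induces maps on both complexes, by sending the summand indexed by $\sigma$ (respectively by $\sigma_0\to\cdots\to\sigma_n$) identically to the summand indexed by its image under $f$, so $(X,F)\mapsto H_n(X,F)$ and $(X,F)\mapsto\varinjlim_n^{(\square_+/X)^{op}}F$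 are functors $\mathcal{HS}\to\mathrm{Ab}$. **Theorem.** For all $n\ge0$ there are isomorphisms $$H_n(X,F)\;\cong\;\varinjlim\nolimits_n^{(\square_+/X)^{op}}F$$ which are natural in $(X,F)\in\mathcal{HS}$. -/

import Mathlib

open CategoryTheory CategoryTheory.Limits Opposite

universe v u

noncomputable section

namespace PrecubicalHomology

/-! ### The category `□₊` -/

/-- An object of `□₊`: the cube `𝕀ⁿ = {0,1}ⁿ`, recorded by its dimension `n`. -/
structure Cube : Type where
  dim : ℕ

/-- The map `δ_i^ε : 𝕀ⁿ → 𝕀ⁿ⁺¹` that inserts `ε` at the place `i`.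
Places are counted from `0`, and `𝕀ⁿ` is `Fin n → Fin 2` with the product order. -/
def delta {n : ℕ} (i : Fin (n + 1)) (ε : Fin 2) :
    (Fin n → Fin 2) →o (Fin (n + 1) → Fin 2) where
  toFun x := i.insertNth (α := fun _ => Fin 2) ε x
  monotone' x y h := by
    intro k
    refine Fin.succAboveCases i ?_ (fun l => ?_) k
    · simp
    · simpa using h l

/-- The ascending maps `𝕀ᵐ → 𝕀ⁿ` that are finite (possibly empty) composites of maps `δ_i^ε`. -/
inductive IsCubeMap : ∀ {m n : ℕ}, ((Fin m → Fin 2) →o (Fin n → Fin 2)) → Prop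
  | id (n : ℕ) : IsCubeMap (OrderHom.id : (Fin n → Fin 2) →o (Fin n → Fin 2))
  | comp_delta {m n : ℕ} (f : (Fin m → Fin 2) →o (Fin n → Fin 2)) (i : Fin (n + 1)) (ε : Fin 2) :
      IsCubeMap f → IsCubeMap ((delta i ε).comp f)

lemma IsCubeMap.comp {l m n : ℕ} {g : (Fin m → Fin 2) →o (Fin n → Fin 2)}
    {f : (Fin l → Fin 2) →o (Fin m → Fin 2)} (hg : IsCubeMap g) (hf : IsCubeMap f) :
    IsCubeMap (g.comp f) := by
  revert hf
  induction hg with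
  | id => exact fun hf => hf
  | comp_delta g i ε _ ih => exact fun hf => IsCubeMap.comp_delta _ i ε (ih hf)

/-- The category `□₊`. -/
instance : Category.{0} Cube where
  Hom a b := { f : (Fin a.dim → Fin 2) →o (Fin b.dim → Fin 2) // IsCubeMap f }
  id a := ⟨OrderHom.id, IsCubeMap.id a.dim⟩
  comp f g := ⟨g.1.comp f.1, g.2.comp f.2⟩

/-- The map `δ_i^ε` as a morphism `𝕀ⁿ ⟶ 𝕀ⁿ⁺¹` of `□₊`. -/
def δ {n : ℕ} (i : Fin (n + 1)) (ε : Fin 2) : Cube.mk n ⟶ Cube.mk (n + 1) :=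
  ⟨delta i ε, IsCubeMap.comp_delta _ i ε (IsCubeMap.id n)⟩

lemma δ_comp_δ {n : ℕ} {i j : Fin (n + 1)} (h : i ≤ j) (α β : Fin 2) :
    δ i α ≫ δ j.succ β = δ j β ≫ δ i.castSucc α := by
  apply Subtype.ext
  apply OrderHom.ext
  funext x
  change (j.succ.insertNth (α := fun _ => Fin 2) β
      (i.insertNth (α := fun _ => Fin 2) α x) : Fin (n + 2) → Fin 2) =
    (i.castSucc.insertNth (α := fun _ => Fin 2) α
      (j.insertNth (α := fun _ => Fin 2) β x) : Fin (n + 2) → Fin 2)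
  have e₁ : i.castSucc = j.succ.succAbove i :=
    (Fin.succAbove_of_castSucc_lt _ _ (Fin.castSucc_lt_succ_iff.2 h)).symm
  have e₂ : i.castSucc.succAbove j = j.succ :=
    Fin.succAbove_of_le_castSucc _ _ (Fin.castSucc_le_castSucc_iff.2 h)
  have e₃ (l : Fin n) :
      i.castSucc.succAbove (j.succAbove l) = j.succ.succAbove (i.succAbove l) := by
    have h' : (i : ℕ) ≤ j := h
    clear e₁ e₂
    ext
    simp only [Fin.succAbove, Fin.lt_def]
    split_ifs <;> simp_all <;> omega
  funext k
  refine Fin.succAboveCases i.castSucc ?_ (fun k' => ?_) k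
  · rw [Fin.insertNth_apply_same, e₁, Fin.insertNth_apply_succAbove, Fin.insertNth_apply_same]
  · rw [Fin.insertNth_apply_succAbove]
    refine Fin.succAboveCases j ?_ (fun l => ?_) k'
    · rw [e₂, Fin.insertNth_apply_same, Fin.insertNth_apply_same]
    · rw [e₃]
      simp only [Fin.insertNth_apply_succAbove]

/-- A precubical set: a functor `□₊ᵒᵖ ⥤ Type`. -/
abbrev PrecubicalSet := Cubeᵒᵖ ⥤ Type u

/-- A precubical abelian group: a functor `□₊ᵒᵖ ⥤ Ab`. -/
abbrev PrecubicalAb := Cubeᵒᵖ ⥤ AddCommGrpCat.{u}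

/-! ### The chain complex of a precubical abelian group -/

/-- The operator `d_i^1 - d_i^0 : G(𝕀ⁿ⁺¹) ⟶ G(𝕀ⁿ)`. -/
def faceDiff (G : PrecubicalAb.{u}) {n : ℕ} (i : Fin (n + 1)) :
    G.obj (op (Cube.mk (n + 1))) ⟶ G.obj (op (Cube.mk n)) :=
  G.map (δ i 1).op - G.map (δ i 0).op

lemma faceDiff_comp (G : PrecubicalAb.{u}) {n : ℕ} {i j : Fin (n + 1)} (h : i ≤ j) :
    faceDiff G j.succ ≫ faceDiff G i = faceDiff G i.castSucc ≫ faceDiff G j := by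
  have key (α β : Fin 2) : G.map (δ j.succ β).op ≫ G.map (δ i α).op =
      G.map (δ i.castSucc α).op ≫ G.map (δ j β).op := by
    rw [← G.map_comp, ← G.map_comp, ← op_comp, ← op_comp, δ_comp_δ h]
  simp only [faceDiff, Preadditive.sub_comp, Preadditive.comp_sub, key]
  abel

/-- The differential `∑_{i=1}^{n+1} (-1)^i (d_i^1 - d_i^0)`; the index `i` below starts from `0`. -/
def cubicalD (G : PrecubicalAb.{u}) (n : ℕ) :
    G.obj (op (Cube.mk (n + 1))) ⟶ G.obj (op (Cube.mk n)) :=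
  ∑ i : Fin (n + 1), (-1 : ℤ) ^ ((i : ℕ) + 1) • faceDiff G i

lemma cubicalD_comp (G : PrecubicalAb.{u}) (n : ℕ) : cubicalD G (n + 1) ≫ cubicalD G n = 0 := by
  simp only [cubicalD, Preadditive.comp_sum, Preadditive.sum_comp, ← Finset.sum_product']
  let P := Fin (n + 1) × Fin (n + 2)
  let S : Finset P := {ij : P | (ij.2 : ℕ) ≤ (ij.1 : ℕ)}
  rw [Finset.univ_product_univ, ← Finset.sum_add_sum_compl S, ← eq_neg_iff_add_eq_zero,
    ← Finset.sum_neg_distrib]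
  let φ : ∀ ij : P, ij ∈ S → P := fun ij hij =>
    (Fin.castLT ij.2 (lt_of_le_of_lt (Finset.mem_filter.mp hij).right (Fin.is_lt ij.1)), ij.1.succ)
  apply Finset.sum_bij φ
  · intro ij hij
    simp_rw [S, φ, Finset.compl_filter, Finset.mem_filter_univ, Fin.val_succ,
      Fin.val_castLT] at hij ⊢
    lia
  · rintro ⟨i, j⟩ hij ⟨i', j'⟩ hij' h
    rw [Prod.mk_inj]
    exact ⟨by simpa [φ] using! congr_arg Prod.snd h,
      by simpa [φ, Fin.castSucc_castLT] using! congr_arg Fin.castSucc (congr_arg Prod.fst h)⟩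
  · rintro ⟨i', j'⟩ hij'
    simp_rw [S, Finset.compl_filter, Finset.mem_filter_univ, not_le] at hij'
    refine ⟨(j'.pred <| ?_, Fin.castSucc i'), ?_, ?_⟩
    · rintro rfl
      simp only [Fin.val_zero, not_lt_zero] at hij'
    · simpa [S] using! Nat.le_sub_one_of_lt hij'
    · simp only [φ, Fin.castLT_castSucc, Fin.succ_pred]
  · rintro ⟨i, j⟩ hij
    have hji : (j : ℕ) ≤ (i : ℕ) := by simpa [S] using! hij
    have hj : j = (Fin.castLT j (lt_of_le_of_lt hji i.is_lt)).castSucc := by simp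
    have hle : Fin.castLT j (lt_of_le_of_lt hji i.is_lt) ≤ i := hji
    have e := faceDiff_comp G hle
    rw [← hj] at e
    dsimp [φ]
    simp only [Preadditive.zsmul_comp, Preadditive.comp_zsmul, smul_smul, ← neg_smul, e]
    congr 1
    simp only [pow_add, pow_one]
    ring

/-- The chain complex `G_*` with `G_n = G(𝕀ⁿ)`. -/
def cubicalComplex (G : PrecubicalAb.{u}) : ChainComplex AddCommGrpCat.{u} ℕ :=
  ChainComplex.of (fun n => G.obj (op (Cube.mk n))) (cubicalD G) (cubicalD_comp G)

lemma cubicalComplex_d (G : PrecubicalAb.{u}) (n : ℕ) :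
    (cubicalComplex G).d (n + 1) n =
      ∑ i : Fin (n + 1), (-1 : ℤ) ^ ((i : ℕ) + 1) • (G.map (δ i 1).op - G.map (δ i 0).op) :=
  ChainComplex.of_d (fun n => G.obj (op (Cube.mk n))) (cubicalD G) n

/-- The chain map `G_* ⟶ G'_*` induced by a natural transformation. -/
def cubicalComplexMap {G G' : PrecubicalAb.{u}} (η : G ⟶ G') :
    cubicalComplex G ⟶ cubicalComplex G' :=
  ChainComplex.ofHom (fun n => η.app (op (Cube.mk n))) fun n => by
    simp [cubicalComplex, cubicalD, faceDiff, Preadditive.comp_sum, Preadditive.sum_comp]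

/-- The functor `G ↦ G_*`. -/
def cubicalComplexFunctor : PrecubicalAb.{u} ⥤ ChainComplex AddCommGrpCat.{u} ℕ where
  obj := cubicalComplex
  map := cubicalComplexMap

/-! ### Homological systems and the complex `C_*(X, F)` -/

/-- The category `(□₊/X)ᵒᵖ`. Its objects are the cubes of `X`, that is pairs `(𝕀ⁿ, σ)` with
`σ ∈ X_n`, and a morphism `σ ⟶ τ`, `σ ∈ X_n`, `τ ∈ X_m`, is a morphism `α : 𝕀ᵐ ⟶ 𝕀ⁿ` of `□₊`
with `X(α)(σ) = τ`, i.e. a morphism `τ ⟶ σ` of `□₊/X`. -/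
abbrev CubesOp (X : PrecubicalSet.{u}) : Type u := X.Elements

/-- The functor `(□₊/f)ᵒᵖ : (□₊/X)ᵒᵖ ⥤ (□₊/Y)ᵒᵖ`, which sends a cube `σ` to `f(σ)`. -/
abbrev cubesMap {X Y : PrecubicalSet.{u}} (f : X ⟶ Y) : CubesOp X ⥤ CubesOp Y where
  obj p := Y.elementsMk p.1 (f.app p.1 p.2)
  map {p q} α := CategoryOfElements.homMk _ _ α.1 (by
    rw [← NatTrans.naturality_apply, CategoryOfElements.map_snd])

/-- A homological system of abelian groups on `X`: a functor `(□₊/X)ᵒᵖ ⥤ Ab`. -/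
abbrev HomSystem (X : PrecubicalSet.{u}) := CubesOp X ⥤ AddCommGrpCat.{u}

lemma map_comp_ι {X : PrecubicalSet.{u}} (F : HomSystem X) {c : Cubeᵒᵖ} {p : CubesOp X}
    {x y : X.obj c} (h : x = y) (f : p ⟶ X.elementsMk c x) (g : p ⟶ X.elementsMk c y)
    (hfg : f.1 = g.1) :
    F.map f ≫ Sigma.ι (fun z : X.obj c => F.obj (X.elementsMk c z)) x =
      F.map g ≫ Sigma.ι (fun z : X.obj c => F.obj (X.elementsMk c z)) y := by
  subst h
  obtain rfl : f = g := Subtype.ext hfg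
  rfl

/-- The precubical abelian group with values `C_n(X, F) = ⨁_{σ ∈ X_n} F(σ)`. For `α : 𝕀ᵐ ⟶ 𝕀ⁿ`
the map `⨁_{σ ∈ X_n} F(σ) ⟶ ⨁_{τ ∈ X_m} F(τ)` sends the summand of `σ` to the summand of
`X(α)(σ)` by the homomorphism `F(α : X(α)(σ) → σ)`. For `α = δ_i^ε` this is `d_i^{n,ε}`. -/
def chains {X : PrecubicalSet.{u}} (F : HomSystem X) : PrecubicalAb.{u} where
  obj c := ∐ fun σ : X.obj c => F.obj (X.elementsMk c σ)
  map {c c'} α := Sigma.map' (X.map α)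
    fun σ => F.map (CategoryOfElements.homMk (X.elementsMk c σ) (X.elementsMk c' (X.map α σ)) α rfl)
  map_id c := by
    refine Sigma.hom_ext _ _ fun σ => ?_
    rw [Sigma.ι_comp_map', Category.comp_id]
    have h : X.map (𝟙 c) σ = σ := by simp
    refine (map_comp_ι F h _ (𝟙 (X.elementsMk c σ)) rfl).trans ?_
    rw [F.map_id, Category.id_comp]
  map_comp α β := by
    refine Sigma.hom_ext _ _ fun σ => ?_
    rw [Sigma.ι_comp_map', Sigma.ι_comp_map'_assoc, Sigma.ι_comp_map', ← Category.assoc,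
      ← F.map_comp]
    exact map_comp_ι F (by simp) _ _ rfl

lemma ι_chains_map {X : PrecubicalSet.{u}} (F : HomSystem X) {c c' : Cubeᵒᵖ} (α : c ⟶ c')
    (σ : X.obj c) :
    Sigma.ι (fun σ : X.obj c => F.obj (X.elementsMk c σ)) σ ≫ (chains F).map α =
      F.map (CategoryOfElements.homMk (X.elementsMk c σ) (X.elementsMk c' (X.map α σ)) α rfl) ≫
        Sigma.ι (fun τ : X.obj c' => F.obj (X.elementsMk c' τ)) (X.map α σ) :=
  Sigma.ι_comp_map' _ _ _

/-- The morphism induced by `f : X ⟶ Y` and a natural transformation `F ⟶ G ∘ (□₊/f)ᵒᵖ`: it sends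
the summand of `σ` to the summand of `f(σ)`. -/
def chainsMap {X Y : PrecubicalSet.{u}} {F : HomSystem X} {G : HomSystem Y} (f : X ⟶ Y)
    (φ : F ⟶ cubesMap f ⋙ G) : chains F ⟶ chains G where
  app c := Sigma.map' (f.app c) fun σ => φ.app (X.elementsMk c σ)
  naturality c c' α := by
    refine Sigma.hom_ext _ _ fun σ => ?_
    dsimp only [chains]
    rw [Sigma.ι_comp_map'_assoc, Sigma.ι_comp_map', Sigma.ι_comp_map'_assoc, Sigma.ι_comp_map',
      ← Category.assoc, φ.naturality, Category.assoc]
    congr 1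
    exact map_comp_ι G (by simp) _ _ rfl

lemma ι_chainsMap {X Y : PrecubicalSet.{u}} {F : HomSystem X} {G : HomSystem Y} (f : X ⟶ Y)
    (φ : F ⟶ cubesMap f ⋙ G) (c : Cubeᵒᵖ) (σ : X.obj c) :
    Sigma.ι (fun σ : X.obj c => F.obj (X.elementsMk c σ)) σ ≫ (chainsMap f φ).app c =
      φ.app (X.elementsMk c σ) ≫
        Sigma.ι (fun τ : Y.obj c => G.obj (Y.elementsMk c τ)) (f.app c σ) :=
  Sigma.ι_comp_map' _ _ _

/-- The homology group `H_n(X, F)` of the complex `C_*(X, F)`. -/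
abbrev homology {X : PrecubicalSet.{u}} (F : HomSystem X) (n : ℕ) : AddCommGrpCat.{u} :=
  (cubicalComplex (chains F)).homology n

/-! ### The groups `colim_n^C F` for a small category `C` -/

section Bar

variable {C : Type u} [Category.{v} C]

/-- The simplicial abelian group with values `⨁_{c₀ → ⋯ → c_n} F(c₀)`. For `θ : [m] → [n]` the
summand of `c = (c₀ → ⋯ → c_n)` is sent to the summand of `c ∘ θ = (c_{θ 0} → ⋯ → c_{θ m})` by
`F(c₀ → c_{θ 0})`. So the face `d_i`, `i ≥ 1`, omits `c_i` and is the identity on `F(c₀)`, and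
`d_0` omits `c₀` and is `F(c₀ → c₁)` on the coefficients. -/
def bar (F : C ⥤ AddCommGrpCat.{max u v}) : SimplicialObject AddCommGrpCat.{max u v} where
  obj Δ := ∐ fun c : ComposableArrows C Δ.unop.len => F.obj (c.obj 0)
  map {Δ Δ'} θ := Sigma.map'
    (fun c => θ.unop.toOrderHom.monotone.functor ⋙ c)
    fun c => F.map (c.map (homOfLE (Fin.zero_le _)))
  map_id Δ := by
    refine Sigma.hom_ext _ _ fun c => ?_
    rw [Sigma.ι_comp_map', Category.comp_id]
    have h : c.map (homOfLE (Fin.zero_le ((𝟙 Δ : Δ ⟶ Δ).unop.toOrderHom 0))) = 𝟙 (c.obj 0) :=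
      c.map_id 0
    refine Eq.trans (congrArg (fun t => F.map t ≫ Sigma.ι (fun c => F.obj (c.obj 0)) c) h) ?_
    exact (congrArg (fun t => t ≫ Sigma.ι (fun c => F.obj (c.obj 0)) c)
      (F.map_id (c.obj 0))).trans (Category.id_comp _)
  map_comp θ θ' := by
    refine Sigma.hom_ext _ _ fun c => ?_
    rw [Sigma.ι_comp_map', Sigma.ι_comp_map'_assoc, Sigma.ι_comp_map', ← Category.assoc,
      ← F.map_comp]
    congr 2
    exact c.map_comp (homOfLE _) (homOfLE _)

/-- The chain complex `C_*(C, F)` with differentials `∑_{i=0}^n (-1)^i d_i`. -/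
def barComplex (F : C ⥤ AddCommGrpCat.{max u v}) : ChainComplex AddCommGrpCat.{max u v} ℕ :=
  (AlgebraicTopology.alternatingFaceMapComplex AddCommGrpCat.{max u v}).obj (bar F)

/-- The group `colim_n^C F`, the `n`-th homology group of `C_*(C, F)`. -/
abbrev colimN (F : C ⥤ AddCommGrpCat.{max u v}) (n : ℕ) : AddCommGrpCat.{max u v} :=
  (barComplex F).homology n

/-- The morphism induced by a functor `S : C ⥤ D` and a natural transformation `F ⟶ G ∘ S`: it
sends the summand of `c₀ → ⋯ → c_n` to the summand of `S c₀ → ⋯ → S c_n`. -/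
def barMap {D : Type u} [Category.{v} D] {F : C ⥤ AddCommGrpCat.{max u v}}
    {G : D ⥤ AddCommGrpCat.{max u v}} (S : C ⥤ D) (φ : F ⟶ S ⋙ G) : bar F ⟶ bar G where
  app Δ := Sigma.map' (fun c => c ⋙ S)
    fun c => φ.app (c.obj 0)
  naturality Δ Δ' θ := by
    refine Sigma.hom_ext _ _ fun c => ?_
    dsimp only [bar]
    rw [Sigma.ι_comp_map'_assoc, Sigma.ι_comp_map', Sigma.ι_comp_map'_assoc, Sigma.ι_comp_map',
      ← Category.assoc, φ.naturality, Category.assoc]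
    rfl

lemma ι_barMap {D : Type u} [Category.{v} D] {F : C ⥤ AddCommGrpCat.{max u v}}
    {G : D ⥤ AddCommGrpCat.{max u v}} (S : C ⥤ D) (φ : F ⟶ S ⋙ G) (Δ : SimplexCategoryᵒᵖ)
    (c : ComposableArrows C Δ.unop.len) :
    Sigma.ι (fun c : ComposableArrows C Δ.unop.len => F.obj (c.obj 0)) c ≫ (barMap S φ).app Δ =
      φ.app (c.obj 0) ≫
        Sigma.ι (fun d : ComposableArrows D Δ.unop.len => G.obj (d.obj 0)) (c ⋙ S) :=
  Sigma.ι_comp_map' _ _ _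

end Bar

/-! ### The category of homological systems -/

/-- An object of `HS`: a precubical set `X` with a homological system `F` on `X`. -/
structure HS where
  X : PrecubicalSet.{u}
  F : HomSystem X

namespace HS

/-- A morphism `(X, F) ⟶ (Y, G)` of `HS`: a morphism `f : X ⟶ Y` of precubical sets with
`G ∘ (□₊/f)ᵒᵖ = F`. -/
@[ext]
structure Hom (A B : HS.{u}) where
  f : A.X ⟶ B.X
  comm : cubesMap f ⋙ B.F = A.F

instance : Category HS.{u} where
  Hom := Hom
  id A := ⟨𝟙 A.X, rfl⟩
  comp {A B C} g h := ⟨g.f ≫ h.f, by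
    rw [← g.comm, ← h.comm]
    rfl⟩

/-- The identity `F = G ∘ (□₊/f)ᵒᵖ` as a natural transformation. -/
def Hom.trans {A B : HS.{u}} (h : A ⟶ B) : A.F ⟶ cubesMap h.f ⋙ B.F :=
  eqToHom h.comm.symm

lemma Hom.trans_app {A B : HS.{u}} (h : A ⟶ B) (p : CubesOp A.X) :
    h.trans.app p = eqToHom (by rw [h.comm]) := by
  simp [Hom.trans]

/-- The functor sending `(X, F)` to the precubical abelian group `⨁_{σ ∈ X_n} F(σ)`. -/
def chainsFunctor : HS.{u} ⥤ PrecubicalAb.{u} where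
  obj A := chains A.F
  map h := chainsMap h.f h.trans
  map_id A := by
    apply NatTrans.ext
    funext c
    refine Sigma.hom_ext _ _ fun σ => ?_
    refine (ι_chainsMap _ _ _ _).trans ?_
    refine Eq.trans ?_ (Category.comp_id _).symm
    rw [Hom.trans_app]
    exact Category.id_comp _
  map_comp g h := by
    apply NatTrans.ext
    funext c
    refine Sigma.hom_ext _ _ fun σ => ?_
    have h₁ := ι_chainsMap (g ≫ h).f (g ≫ h).trans c σ
    have h₂ := ι_chainsMap g.f g.trans c σ
    have h₃ := ι_chainsMap h.f h.trans c (g.f.app c σ)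
    have h₄ := (Category.assoc _ _ _).symm.trans ((congrArg (· ≫ (chainsMap h.f h.trans).app c)
      h₂).trans ((Category.assoc _ _ _).trans (congrArg (g.trans.app _ ≫ ·) h₃)))
    refine h₁.trans (Eq.trans ?_ h₄.symm)
    simp only [Hom.trans_app]
    exact (eqToHom_trans_assoc _ _ _).symm

/-- The functor `(X, F) ↦ H_n(X, F)`. -/
def homologyFunctor (n : ℕ) : HS.{u} ⥤ AddCommGrpCat.{u} :=
  chainsFunctor ⋙ cubicalComplexFunctor ⋙ HomologicalComplex.homologyFunctor _ _ n

/-- The functor sending `(X, F)` to the simplicial abelian group `bar F`. -/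
def barFunctor : HS.{u} ⥤ SimplicialObject AddCommGrpCat.{u} where
  obj A := bar A.F
  map h := barMap (cubesMap h.f) h.trans
  map_id A := by
    apply NatTrans.ext
    funext c
    refine Sigma.hom_ext _ _ fun σ => ?_
    refine (ι_barMap _ _ _ _).trans ?_
    refine Eq.trans ?_ (Category.comp_id _).symm
    rw [Hom.trans_app]
    rfl
  map_comp g h := by
    apply NatTrans.ext
    funext c
    refine Sigma.hom_ext _ _ fun σ => ?_
    have h₁ := ι_barMap (cubesMap (g ≫ h).f) (g ≫ h).trans c σ
    have h₂ := ι_barMap (cubesMap g.f) g.trans c σ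
    have h₃ := ι_barMap (cubesMap h.f) h.trans c (σ ⋙ cubesMap g.f)
    have h₄ := (Category.assoc _ _ _).symm.trans ((congrArg
      (· ≫ (barMap (cubesMap h.f) h.trans).app c)
      h₂).trans ((Category.assoc _ _ _).trans (congrArg (g.trans.app _ ≫ ·) h₃)))
    refine h₁.trans (Eq.trans ?_ h₄.symm)
    simp only [Hom.trans_app]
    exact (eqToHom_trans_assoc _ _ _).symm

/-- The functor `(X, F) ↦ colim_n F`, the colimit being over `(□₊/X)ᵒᵖ`. -/
def colimFunctor (n : ℕ) : HS.{u} ⥤ AddCommGrpCat.{u} :=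
  barFunctor ⋙ AlgebraicTopology.alternatingFaceMapComplex AddCommGrpCat.{u} ⋙
    HomologicalComplex.homologyFunctor _ _ n

lemma homologyFunctor_obj (n : ℕ) (A : HS.{u}) :
    (homologyFunctor n).obj A = homology A.F n := rfl

lemma colimFunctor_obj (n : ℕ) (A : HS.{u}) :
    (colimFunctor n).obj A = colimN A.F n := rfl

end HS

end PrecubicalHomology

end

/-! The proof is by acyclic models. Fix `X`, put `C = (□₊/X)ᵒᵖ`, and regard both complexes as
complexes of functors of the coefficient system `F : C ⥤ Ab`, augmented over `colim F`. The models
are the functors `c' ↦ ∐_{c ⟶ c'} M`, whose colimit is `M` (`modelColim`).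

Each term of either complex has the form `∐_j F(c_j)`. By a Yoneda argument such a functor of `F`
lifts through every sequence that splits on the models, naturally in `M`
(`modelProjective_of_coproduct`). On a model both augmented complexes have a contraction natural in
`M`. For the bar complex it is the extra degeneracy that puts `c` in front of a string (`barExtra`).
For the cubical complex, the chains with coefficients in the model at `σ ∈ X_m` are the chains of
the standard cube `𝕀ᵐ` with coefficients in `M`, which contract by induction on `m`, collapsing the
cube onto the face `x₁ = 0` (`cubeContr`). So both complexes are relatively projective resolutions
of `colim`, and the comparison theorem `IsModelResolution.exists_homotopyEquiv` gives a homotopy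
equivalence natural in `F`.

The equivalence is chosen separately for each `X`, so naturality in `X` needs its own argument. For
`f : X ⟶ Y` the two ways around the square are chain maps `C_*(X, G ∘ (□₊/f)ᵒᵖ) ⟶ C_*((□₊/Y)ᵒᵖ, G)`,
natural in `G` and equal after augmentation. The source is relatively projective over `(□₊/Y)ᵒᵖ` and
the target is a resolution, so they are homotopic (`comparison_naturality`). -/

noncomputable section

namespace PrecubicalHomology

/-! ### Relative projectivity with respect to models -/

section Models

universe w₁ w₂

variable {C : Type u} [Category.{v} C] {A : Type w₁} [Category.{w₂} A] [HasCoproducts.{v} A]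

/-- The functor `M ↦ (c' ↦ ∐_{c ⟶ c'} M)`. -/
def model (c : C) : A ⥤ C ⥤ A :=
  sigmaConst ⋙ (Functor.whiskeringLeft _ _ _).obj (coyoneda.obj (op c))

/-- The inclusion of the summand of `g`. -/
def modelι {c c' : C} (M : A) (g : c ⟶ c') : M ⟶ ((model c).obj M).obj c' :=
  Sigma.ι (fun _ : (c ⟶ c') => M) g

/-- The morphism with given restrictions to the summands. -/
def modelDesc {c c' : C} {M N : A} (f : (c ⟶ c') → (M ⟶ N)) : ((model c).obj M).obj c' ⟶ N :=
  Sigma.desc f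

@[simp]
lemma modelι_desc {c c' : C} {M N : A} (f : (c ⟶ c') → (M ⟶ N)) (g : c ⟶ c') :
    modelι M g ≫ modelDesc f = f g :=
  Sigma.ι_desc _ _

@[simp]
lemma modelι_desc_assoc {c c' : C} {M N : A} (f : (c ⟶ c') → (M ⟶ N)) (g : c ⟶ c')
    {Z : A} (h : _ ⟶ Z) :
    modelι M g ≫ modelDesc f ≫ h =
      f g ≫ h := by
  rw [reassoc_of% modelι_desc]

lemma model_hom_ext {c c' : C} {M N : A} {f g : ((model c).obj M).obj c' ⟶ N}
    (h : ∀ a, modelι M a ≫ f = modelι M a ≫ g) : f = g :=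
  Sigma.hom_ext _ _ h

@[simp]
lemma modelι_map (c : C) (M : A) {c' c'' : C} (f : c' ⟶ c'') (g : c ⟶ c') :
    modelι M g ≫ ((model c).obj M).map f = modelι M (g ≫ f) := by
  simp [sigmaConst, modelι, model]

@[simp]
lemma modelι_map_assoc (c : C) (M : A) {c' c'' : C} (f : c' ⟶ c'') (g : c ⟶ c')
    {Z : A} (h : _ ⟶ Z) :
    modelι M g ≫ ((model c).obj M).map f ≫ h =
      modelι M (g ≫ f) ≫ h := by
  rw [reassoc_of% modelι_map]

@[simp]
lemma modelι_map_app (c : C) {M N : A} {c' : C} (φ : M ⟶ N) (g : c ⟶ c') :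
    modelι M g ≫ ((model c).map φ).app c' = φ ≫ modelι N g := by
  simp [sigmaConst, modelι, model]

@[simp]
lemma modelι_map_app_assoc (c : C) {M N : A} {c' : C} (φ : M ⟶ N) (g : c ⟶ c') {Z : A} (h : _ ⟶ Z) :
    modelι M g ≫ ((model c).map φ).app c' ≫ h =
      φ ≫ modelι N g ≫ h := by
  rw [reassoc_of% modelι_map_app]

/-- The transformation `∐_{c ⟶ c'} F(c) ⟶ F(c')` which is `F(g)` on the summand of `g`. -/
def modelCounit (F : C ⥤ A) (c : C) : (model c).obj (F.obj c) ⟶ F where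
  app c' := modelDesc fun g : c ⟶ c' => F.map g
  naturality c' c'' f := by
    refine model_hom_ext fun g => ?_
    simp

@[simp]
lemma modelι_counit (F : C ⥤ A) {c c' : C} (g : c ⟶ c') :
    modelι (F.obj c) g ≫ (modelCounit F c).app c' = F.map g := by
  simp [modelCounit]

@[simp]
lemma modelι_counit_assoc (F : C ⥤ A) {c c' : C} (g : c ⟶ c') {Z : A} (h : _ ⟶ Z) :
    modelι (F.obj c) g ≫ (modelCounit F c).app c' ≫ h =
      F.map g ≫ h := by
  rw [reassoc_of% modelι_counit]

lemma modelCounit_naturality {F G : C ⥤ A} (η : F ⟶ G) (c : C) :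
    (model c).map (η.app c) ≫ modelCounit G c = modelCounit F c ≫ η := by
  apply NatTrans.ext
  funext c'
  exact model_hom_ext fun g => by simp

variable [Preadditive A]

/-- A sequence of functors `(C ⥤ A) ⥤ A` is exact on models if it is split exact at the middle
term on every functor `c' ↦ ∐_{c ⟶ c'} M`, with a contraction natural in `M`. -/
def ModelExact {T₁ T₂ T₃ : (C ⥤ A) ⥤ A} (f : T₁ ⟶ T₂) (g : T₂ ⟶ T₃) : Prop :=
  ∀ c : C, ∃ (h : model c ⋙ T₂ ⟶ model c ⋙ T₁) (k : model c ⋙ T₃ ⟶ model c ⋙ T₂),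
    h ≫ Functor.whiskerLeft (model c) f + Functor.whiskerLeft (model c) g ≫ k = 𝟙 _

/-- Projectivity relative to the sequences that are exact on models. -/
def ModelProjective (T : (C ⥤ A) ⥤ A) : Prop :=
  ∀ ⦃T₁ T₂ T₃ : (C ⥤ A) ⥤ A⦄ (f : T₁ ⟶ T₂) (g : T₂ ⟶ T₃), ModelExact f g →
    ∀ z : T ⟶ T₂, z ≫ g = 0 → ∃ w : T ⟶ T₁, w ≫ f = z

/-- A functor with values `∐_j F(c_j)` is projective relative to the models. -/
lemma modelProjective_of_coproduct {T : (C ⥤ A) ⥤ A} {J : Type*} (c : J → C)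
    (ι : ∀ (j : J) (F : C ⥤ A), F.obj (c j) ⟶ T.obj F)
    (nat : ∀ (j : J) {F G : C ⥤ A} (η : F ⟶ G), η.app (c j) ≫ ι j G = ι j F ≫ T.map η)
    (hι : ∀ F, Nonempty (IsColimit (Cofan.mk (T.obj F) fun j => ι j F))) :
    ModelProjective T := by
  intro T₁ T₂ T₃ f g hfg z hz
  choose h k e using hfg
  have hι' (F) := (hι F).some
  have ext {F : C ⥤ A} {M : A} {a b : T.obj F ⟶ M}
      (hab : ∀ j, ι j F ≫ a = ι j F ≫ b) : a = b :=
    Cofan.IsColimit.hom_ext (hι' F) _ _ hab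
  -- The Yoneda step: the universal element of the model at `c j` with `M = F(c j)` is lifted there
  -- by the contraction `h`, and the result is carried to `F` by the counit.
  let w (F : C ⥤ A) (j : J) : F.obj (c j) ⟶ T₁.obj F :=
    modelι (F.obj (c j)) (𝟙 _) ≫ ι j _ ≫ z.app _ ≫ (h (c j)).app (F.obj (c j)) ≫
      T₁.map (modelCounit F (c j))
  have w_nat {F G : C ⥤ A} (η : F ⟶ G) (j : J) :
      η.app (c j) ≫ w G j = w F j ≫ T₁.map η := by
    dsimp only [w]
    rw [← modelι_map_app_assoc, reassoc_of% (nat j ((model (c j)).map (η.app (c j)))),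
      z.naturality_assoc]
    have h₁ := (h (c j)).naturality (η.app (c j))
    dsimp at h₁
    rw [reassoc_of% h₁, ← T₁.map_comp, modelCounit_naturality]
    simp
  have w_comp (F : C ⥤ A) (j : J) : w F j ≫ f.app F = ι j F ≫ z.app F := by
    dsimp only [w]
    have e₁ := congrArg (fun t => t.app (F.obj (c j))) (e (c j))
    dsimp at e₁
    -- Since `z ≫ g = 0`, the term with `k` disappears and `h ≫ f` acts as the identity on the image
    -- of `z`.
    have e₂ : (h (c j)).app (F.obj (c j)) ≫ f.app _ = 𝟙 _ - g.app _ ≫ (k (c j)).app _ :=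
      eq_sub_of_add_eq e₁
    have e₃ : z.app ((model (c j)).obj (F.obj (c j))) ≫ g.app _ = 0 := by
      rw [← NatTrans.comp_app, hz]
      rfl
    simp only [Category.assoc, f.naturality]
    rw [reassoc_of% e₂, Preadditive.sub_comp, Preadditive.comp_sub, Category.assoc,
      reassoc_of% e₃]
    simp only [Category.id_comp, zero_comp, sub_zero]
    -- The counit sends the summand of `𝟙` identically to `F(c j)`, so only `ι j F ≫ z` remains.
    rw [← z.naturality, ← reassoc_of% (nat j (modelCounit F (c j))), modelι_counit_assoc]
    simp
  let W (F : C ⥤ A) : T.obj F ⟶ T₁.obj F := Cofan.IsColimit.desc (hι' F) (w F)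
  have hW (F : C ⥤ A) (j : J) : ι j F ≫ W F = w F j := Cofan.IsColimit.fac (hι' F) _ _
  refine ⟨{ app := W, naturality := fun F G η => ext fun j => ?_ }, ?_⟩
  · rw [← reassoc_of% (nat j η), hW, w_nat, ← hW, Category.assoc]
  · apply NatTrans.ext
    funext F
    exact ext fun j => by rw [NatTrans.comp_app, reassoc_of% (hW F j), w_comp]

/-! ### Comparison of resolutions relative to the models -/

/-- A resolution of `D` relative to the models. -/
structure IsModelResolution (K : ChainComplex ((C ⥤ A) ⥤ A) ℕ) {D : (C ⥤ A) ⥤ A}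
    (ε : K.X 0 ⟶ D) : Prop where
  d_comp : K.d 1 0 ≫ ε = 0
  exact_succ (n : ℕ) : ModelExact (K.d (n + 2) (n + 1)) (K.d (n + 1) n)
  exact_zero : ModelExact (K.d 1 0) ε
  exact_target : ModelExact ε (0 : D ⟶ D)

variable {K K' : ChainComplex ((C ⥤ A) ⥤ A) ℕ} {D : (C ⥤ A) ⥤ A} {ε : K.X 0 ⟶ D}
  {ε' : K'.X 0 ⟶ D}

/-- The usual inductive lifting. Degree 0 uses `exact_target`, which says that `ε'` is a split
epimorphism on models; degree 1 uses `exact_zero`, and the higher degrees `exact_succ`. -/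
lemma IsModelResolution.exists_lift (hK : ∀ n, ModelProjective (K.X n)) (hε : K.d 1 0 ≫ ε = 0)
    (h : IsModelResolution K' ε') : ∃ φ : K ⟶ K', φ.f 0 ≫ ε' = ε := by
  obtain ⟨z, hz⟩ := hK 0 _ _ h.exact_target ε comp_zero
  obtain ⟨o, ho⟩ := hK 1 _ _ h.exact_zero (K.d 1 0 ≫ z) (by rw [Category.assoc, hz, hε])
  refine ⟨ChainComplex.mkHom K K' z o ho fun n p => ?_, hz⟩
  have := hK (n + 2) _ _ (h.exact_succ n) (K.d (n + 2) (n + 1) ≫ p.2.1)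
    (by rw [Category.assoc, p.2.2, K.d_comp_d_assoc, zero_comp])
  exact ⟨this.choose, this.choose_spec⟩

/-- At each stage `φ` minus the part of the homotopy already built is annihilated by the
differential of `K'`, so it lifts by projectivity. -/
lemma IsModelResolution.homotopy_zero (hK : ∀ n, ModelProjective (K.X n))
    (h : IsModelResolution K' ε') (φ : K ⟶ K') (hφ : φ.f 0 ≫ ε' = 0) :
    Nonempty (Homotopy φ 0) := by
  obtain ⟨z, hz⟩ := hK 0 _ _ h.exact_zero (φ.f 0) hφ
  obtain ⟨o, ho⟩ := hK 1 _ _ (h.exact_succ 0) (φ.f 1 - K.d 1 0 ≫ z)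
    (by rw [Preadditive.sub_comp, Category.assoc, hz, φ.comm, sub_self])
  refine ⟨Homotopy.mkInductive φ z hz.symm o (by rw [ho]; abel) fun n p => ?_⟩
  have := hK (n + 2) _ _ (h.exact_succ (n + 1)) (φ.f (n + 2) - K.d (n + 2) (n + 1) ≫ p.2.1)
    (by
      have e : p.2.1 ≫ K'.d (n + 2) (n + 1) = φ.f (n + 1) - K.d (n + 1) n ≫ p.1 := by
        refine eq_sub_of_add_eq' p.2.2.symm
      rw [Preadditive.sub_comp, Category.assoc, e, φ.comm, Preadditive.comp_sub,
        K.d_comp_d_assoc, zero_comp, sub_zero, sub_self])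
  exact ⟨this.choose, by rw [this.choose_spec]; abel⟩

lemma IsModelResolution.homotopy (hK : ∀ n, ModelProjective (K.X n))
    (h : IsModelResolution K' ε') {φ ψ : K ⟶ K'} (hφ : φ.f 0 ≫ ε' = ψ.f 0 ≫ ε') :
    Nonempty (Homotopy φ ψ) :=
  (h.homotopy_zero hK (φ - ψ) (by
    rw [HomologicalComplex.sub_f_apply, Preadditive.sub_comp, hφ, sub_self])).map
    Homotopy.equivSubZero.symm

/-- Projective resolutions relative to the models of the same functor are homotopy equivalent. -/
lemma IsModelResolution.exists_homotopyEquiv (hK : ∀ n, ModelProjective (K.X n))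
    (hK' : ∀ n, ModelProjective (K'.X n)) (h : IsModelResolution K ε)
    (h' : IsModelResolution K' ε') : ∃ e : HomotopyEquiv K K', e.hom.f 0 ≫ ε' = ε := by
  obtain ⟨φ, hφ⟩ := h'.exists_lift hK h.d_comp
  obtain ⟨ψ, hψ⟩ := h.exists_lift hK' h'.d_comp
  exact ⟨⟨φ, ψ, (h.homotopy hK (by simp [hφ, hψ])).some,
    (h'.homotopy hK' (by simp [hφ, hψ])).some⟩, hφ⟩

end Models

/-! ### The contraction of the bar complex on models -/

section BarContraction

open Simplicial

/-- The map `[m + 1] → [n + 1]` that preserves `0` and is `f` on the other elements. -/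
def succMap {m n : ℕ} (f : Fin (m + 1) →o Fin (n + 1)) : Fin (m + 2) →o Fin (n + 2) where
  toFun j := match j with
    | ⟨0, _⟩ => 0
    | ⟨j + 1, h⟩ => (f ⟨j, by lia⟩).succ
  monotone' := by
    rintro ⟨_ | i, hi⟩ ⟨_ | j, hj⟩ h
    · exact le_rfl
    · exact Fin.zero_le _
    · simp at h
    · exact Fin.succ_le_succ_iff.2 (f.monotone (by simpa using h))

lemma δ_succ_toOrderHom {n : ℕ} (i : Fin (n + 2)) :
    (SimplexCategory.δ i.succ).toOrderHom = succMap (SimplexCategory.δ i).toOrderHom := by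
  apply OrderHom.ext
  funext j
  refine Fin.cases ?_ (fun j => ?_) j
  · exact Fin.succ_succAbove_zero i
  · exact Fin.succ_succAbove_succ i j

variable {C : Type u} [Category.{v} C]

/-- Restricting a string that has `x` in front, along a map fixing that first place, is the same as
restricting the string and then putting `x` in front. If `f 0 ≠ 0`, the new first arrow absorbs the
arrows that were skipped. -/
lemma succMap_precomp {m n : ℕ} (f : Fin (m + 1) →o Fin (n + 1)) (c : ComposableArrows C n)
    {x : C} (g : x ⟶ c.left) :
    ((succMap f).monotone.functor ⋙ c.precomp g : ComposableArrows C (m + 1)) =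
      ComposableArrows.precomp (f.monotone.functor ⋙ c)
        (g ≫ c.map (homOfLE (Fin.zero_le (f 0)))) := by
  have key (k : Fin (n + 1)) : ComposableArrows.Precomp.map c g 0 k.succ (Fin.zero_le _) =
      g ≫ c.map (homOfLE (Fin.zero_le k)) := by
    obtain ⟨_ | k, hk⟩ := k
    · exact (Category.comp_id _).symm.trans (congrArg (g ≫ ·) (c.map_id 0).symm)
    · rfl
  refine ComposableArrows.ext_succ rfl rfl ?_
  exact (key (f 0)).trans ((Category.id_comp _).trans (Category.comp_id _)).symm

/-- The inclusion of the summand of `c₀ → ⋯ → c_n`. -/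
def barι (F : C ⥤ AddCommGrpCat.{max u v}) {n : ℕ} (c : ComposableArrows C n) :
    F.obj c.left ⟶ (bar F).obj (op ⦋n⦌) :=
  Sigma.ι (fun c : ComposableArrows C n => F.obj (c.obj 0)) c

lemma bar_hom_ext {F : C ⥤ AddCommGrpCat.{max u v}} {n : ℕ} {N : AddCommGrpCat.{max u v}}
    {f g : (bar F).obj (op ⦋n⦌) ⟶ N} (h : ∀ c, barι F c ≫ f = barι F c ≫ g) : f = g :=
  Sigma.hom_ext _ _ h

/-- The morphism with given restrictions to the summands. -/
def barDesc {F : C ⥤ AddCommGrpCat.{max u v}} {n : ℕ} {N : AddCommGrpCat.{max u v}}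
    (f : ∀ c : ComposableArrows C n, F.obj c.left ⟶ N) : (bar F).obj (op ⦋n⦌) ⟶ N :=
  Sigma.desc f

@[simp]
lemma barι_desc {F : C ⥤ AddCommGrpCat.{max u v}} {n : ℕ} {N : AddCommGrpCat.{max u v}}
    (f : ∀ c : ComposableArrows C n, F.obj c.left ⟶ N) (c : ComposableArrows C n) :
    barι F c ≫ barDesc f = f c :=
  Sigma.ι_desc _ _

lemma barι_map (F : C ⥤ AddCommGrpCat.{max u v}) {m n : ℕ} (θ : ⦋m⦌ ⟶ ⦋n⦌)
    (c : ComposableArrows C n) :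
    barι F c ≫ (bar F).map θ.op =
      F.map (c.map (homOfLE (Fin.zero_le (θ.toOrderHom 0)))) ≫
        barι F (θ.toOrderHom.monotone.functor ⋙ c : ComposableArrows C m) :=
  Sigma.ι_comp_map' _ _ _

variable (c : C) (M : AddCommGrpCat.{max u v})

/-- The inclusion of `M` in `⨁_{c₀ → ⋯ → c_n} ⨁_{c → c₀} M` as the summand of
`c → c₀ → ⋯ → c_n`. -/
def barGen {n : ℕ} (a : ComposableArrows C n) (g : c ⟶ a.left) :
    M ⟶ (bar ((model c).obj M)).obj (op ⦋n⦌) :=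
  modelι M g ≫ barι _ a

lemma barGen_congr {n : ℕ} {a b : ComposableArrows C n} (h : a = b) (g : c ⟶ a.left)
    (g' : c ⟶ b.left) (hg : g ≫ eqToHom (by rw [h]) = g') : barGen c M a g = barGen c M b g' := by
  subst h hg
  simp

lemma barGen_hom_ext {n : ℕ} {N : AddCommGrpCat.{max u v}}
    {f g : (bar ((model c).obj M)).obj (op ⦋n⦌) ⟶ N}
    (h : ∀ (a : ComposableArrows C n) (e : c ⟶ a.left),
      barGen c M a e ≫ f = barGen c M a e ≫ g) : f = g :=
  bar_hom_ext fun a => model_hom_ext fun e => by simpa [barGen] using h a e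

lemma barGen_map {m n : ℕ} (θ : ⦋m⦌ ⟶ ⦋n⦌) (a : ComposableArrows C n) (g : c ⟶ a.left) :
    barGen c M a g ≫ (bar ((model c).obj M)).map θ.op =
      barGen c M (θ.toOrderHom.monotone.functor ⋙ a : ComposableArrows C m)
        (g ≫ a.map (homOfLE (Fin.zero_le (θ.toOrderHom 0)))) := by
  exact (Category.assoc _ _ _).trans ((congrArg (modelι M g ≫ ·) (barι_map _ θ a)).trans
    (modelι_map_assoc c M _ g _))

/-- The extra degeneracy, which sends the summand of `c → c₀ → ⋯ → c_n` to that of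
`c = c → c₀ → ⋯ → c_n`. -/
def barExtra (n : ℕ) :
    (bar ((model c).obj M)).obj (op ⦋n⦌) ⟶ (bar ((model c).obj M)).obj (op ⦋n + 1⦌) :=
  barDesc fun a => modelDesc fun g => barGen c M (a.precomp g) (𝟙 c)

@[simp]
lemma barGen_extra {n : ℕ} (a : ComposableArrows C n) (g : c ⟶ a.left) :
    barGen c M a g ≫ barExtra c M n = barGen c M (a.precomp g) (𝟙 c) := by
  simp [barGen, barExtra]

@[simp]
lemma barGen_extra_assoc {n : ℕ} (a : ComposableArrows C n) (g : c ⟶ a.left)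
    {Z : AddCommGrpCat.{max u v}} (h : _ ⟶ Z) :
    barGen c M a g ≫ barExtra c M n ≫ h =
      barGen c M (a.precomp g) (𝟙 c) ≫ h := by
  rw [reassoc_of% barGen_extra]

/-- The augmentation `⨁_{c₀} ⨁_{c → c₀} M ⟶ M`. -/
def barAug : (bar ((model c).obj M)).obj (op ⦋0⦌) ⟶ M :=
  barDesc fun _ => modelDesc fun _ => 𝟙 M

@[simp]
lemma barGen_aug (a : ComposableArrows C 0) (g : c ⟶ a.left) :
    barGen c M a g ≫ barAug c M = 𝟙 M := by
  simp [barGen, barAug]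

@[simp]
lemma barGen_aug_assoc (a : ComposableArrows C 0) (g : c ⟶ a.left)
    {Z : AddCommGrpCat.{max u v}} (h : _ ⟶ Z) :
    barGen c M a g ≫ barAug c M ≫ h =
      h := by
  rw [reassoc_of% barGen_aug]

/-- The section `M ⟶ ⨁_{c₀} ⨁_{c → c₀} M` with values in the summand of the identity of `c`. -/
def barSection : M ⟶ (bar ((model c).obj M)).obj (op ⦋0⦌) :=
  barGen c M (ComposableArrows.mk₀ c) (𝟙 c)

/-- Deleting the inserted object `c` composes `𝟙 c` with `g` and so restores the original summand.
-/
lemma barExtra_δ_zero (n : ℕ) : barExtra c M n ≫ (bar ((model c).obj M)).δ 0 = 𝟙 _ := by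
  refine barGen_hom_ext c M fun a g => ?_
  rw [barGen_extra_assoc, Category.comp_id]
  refine (barGen_map c M (SimplexCategory.δ 0) _ _).trans ?_
  refine barGen_congr c M rfl _ _ ?_
  exact (Category.comp_id _).trans (Category.id_comp _)

lemma barExtra_δ_succ (n : ℕ) (i : Fin (n + 2)) :
    barExtra c M (n + 1) ≫ (bar ((model c).obj M)).δ i.succ =
      (bar ((model c).obj M)).δ i ≫ barExtra c M n := by
  refine barGen_hom_ext c M fun a g => ?_
  rw [barGen_extra_assoc]
  refine (barGen_map c M (SimplexCategory.δ i.succ) _ _).trans ?_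
  refine Eq.trans ?_ (((barGen_map c M (SimplexCategory.δ i) a g).symm =≫ _).trans
    (Category.assoc _ _ _))
  refine Eq.trans ?_ (barGen_extra c M _ _).symm
  have key {f : Fin (n + 2) →o Fin (n + 3)} {f' : Fin (n + 1) →o Fin (n + 2)}
      (h : f = succMap f') :
      barGen c M (f.monotone.functor ⋙ a.precomp g : ComposableArrows C (n + 1))
        (𝟙 c ≫ (a.precomp g).map (homOfLE (Fin.zero_le (f 0)))) =
      barGen c M (ComposableArrows.precomp (f'.monotone.functor ⋙ a)
        (g ≫ a.map (homOfLE (Fin.zero_le (f' 0))))) (𝟙 c) := by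
    subst h
    refine barGen_congr c M (succMap_precomp f' a g) _ _ ?_
    exact (Category.comp_id _).trans (Category.comp_id _)
  exact key (δ_succ_toOrderHom i)

/-- Deleting `c₀` from `c → c₀` leaves the string `c`, whatever `c₀` was. -/
lemma barExtra_zero_δ_one :
    barExtra c M 0 ≫ (bar ((model c).obj M)).δ 1 = barAug c M ≫ barSection c M := by
  refine barGen_hom_ext c M fun a g => ?_
  rw [barGen_extra_assoc, barGen_aug_assoc]
  refine (barGen_map c M (SimplexCategory.δ 1) _ _).trans ?_
  refine barGen_congr c M (ComposableArrows.ext₀ (F := _ ⋙ a.precomp g)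
    (G := ComposableArrows.mk₀ c) rfl) _ _ ?_
  exact (Category.comp_id _).trans (Category.comp_id _)

end BarContraction

/-! ### Contractions from extra degeneracies -/

section

open Simplicial

variable {A : Type*} [Category* A] [Preadditive A] (X : SimplicialObject A)
  (s : ∀ n, ((AlgebraicTopology.alternatingFaceMapComplex A).obj X).X n ⟶
    ((AlgebraicTopology.alternatingFaceMapComplex A).obj X).X (n + 1))

/-- Splitting off the face `0` gives `d = δ 0 - ∑ (-1)^i δ (i+1)`. Composed with `s`, the first term
is the identity and the sum becomes `d ≫ s`, by the shift relation `h`. -/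
lemma contraction_of_extra (h₀ : ∀ n, s n ≫ X.δ 0 = 𝟙 _)
    (h : ∀ (n : ℕ) (i : Fin (n + 2)), s (n + 1) ≫ X.δ i.succ = X.δ i ≫ s n) (n : ℕ) :
    s (n + 1) ≫ ((AlgebraicTopology.alternatingFaceMapComplex A).obj X).d (n + 2) (n + 1) +
      ((AlgebraicTopology.alternatingFaceMapComplex A).obj X).d (n + 1) n ≫ s n = 𝟙 _ := by
  have e₁ : ((AlgebraicTopology.alternatingFaceMapComplex A).obj X).d (n + 1) n =
      ∑ i : Fin (n + 2), (-1 : ℤ) ^ (i : ℕ) • X.δ i :=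
    AlgebraicTopology.AlternatingFaceMapComplex.obj_d_eq X n
  have e₂ : ((AlgebraicTopology.alternatingFaceMapComplex A).obj X).d (n + 2) (n + 1) =
      X.δ 0 - ∑ i : Fin (n + 2), (-1 : ℤ) ^ (i : ℕ) • X.δ i.succ := by
    refine (AlgebraicTopology.AlternatingFaceMapComplex.obj_d_eq X (n + 1)).trans ?_
    rw [Fin.sum_univ_succ]
    simp [pow_succ, sub_eq_add_neg]
  rw [e₁, e₂, Preadditive.comp_sub, Preadditive.comp_sum, Preadditive.sum_comp, h₀]
  simp only [Preadditive.comp_zsmul, Preadditive.zsmul_comp]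
  rw [sub_add_eq_add_sub, sub_eq_iff_eq_add]
  congr 1
  exact Finset.sum_congr rfl fun i _ => congrArg _ (h n i).symm

lemma contraction_zero_of_extra (h₀ : s 0 ≫ X.δ 0 = 𝟙 _)
    {M : A} (a : ((AlgebraicTopology.alternatingFaceMapComplex A).obj X).X 0 ⟶ M)
    (b : M ⟶ ((AlgebraicTopology.alternatingFaceMapComplex A).obj X).X 0)
    (h : s 0 ≫ X.δ 1 = a ≫ b) :
    s 0 ≫ ((AlgebraicTopology.alternatingFaceMapComplex A).obj X).d 1 0 + a ≫ b = 𝟙 _ := by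
  have e : ((AlgebraicTopology.alternatingFaceMapComplex A).obj X).d 1 0 = X.δ 0 - X.δ 1 := by
    refine (AlgebraicTopology.AlternatingFaceMapComplex.obj_d_eq X 0).trans ?_
    rw [Fin.sum_univ_two]
    simp [sub_eq_add_neg]
  rw [e, Preadditive.comp_sub, h₀, h]
  exact sub_add_cancel _ _

end

/-! ### Morphisms of `□₊` into a product with an interval -/

section Star

lemma delta_zero_apply {n : ℕ} (ε : Fin 2) (x : Fin n → Fin 2) :
    delta 0 ε x = (Fin.cons ε x : Fin (n + 1) → Fin 2) :=
  Fin.insertNth_zero' ε x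

lemma delta_succ_cons {n : ℕ} (i : Fin (n + 1)) (ε a : Fin 2) (x : Fin n → Fin 2) :
    delta i.succ ε (Fin.cons a x : Fin (n + 1) → Fin 2) =
      (Fin.cons a (delta i ε x) : Fin (n + 2) → Fin 2) := by
  change (Fin.insertNth i.succ ε (Fin.cons a x : Fin (n + 1) → Fin 2) : Fin (n + 2) → Fin 2) =
    Fin.cons a (i.insertNth ε x)
  funext k
  refine Fin.succAboveCases i.succ ?_ (fun k => ?_) k
  · simp
  · rw [Fin.insertNth_apply_succAbove]
    refine Fin.cases ?_ (fun k => ?_) k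
    · simp
    · simp

/-- The map `id × f`. -/
def star {m n : ℕ} (f : (Fin m → Fin 2) →o (Fin n → Fin 2)) :
    (Fin (m + 1) → Fin 2) →o (Fin (n + 1) → Fin 2) where
  toFun x := Fin.cons (x 0) (f (Fin.tail x))
  monotone' x y h := by
    intro k
    refine Fin.cases (h 0) (fun k => ?_) k
    exact f.monotone (fun j => h j.succ) k

lemma star_id (n : ℕ) : star (OrderHom.id : (Fin n → Fin 2) →o _) = OrderHom.id := by
  apply OrderHom.ext
  funext x
  exact Fin.cons_self_tail x

lemma star_delta_comp {m n : ℕ} (f : (Fin m → Fin 2) →o (Fin n → Fin 2)) (i : Fin (n + 1))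
    (ε : Fin 2) : star ((delta i ε).comp f) = (delta i.succ ε).comp (star f) := by
  apply OrderHom.ext
  funext x
  exact (delta_succ_cons i ε _ _).symm

lemma star_comp_delta {m n : ℕ} (f : (Fin (m + 1) → Fin 2) →o (Fin n → Fin 2)) (i : Fin (m + 1))
    (ε : Fin 2) : star (f.comp (delta i ε)) = (star f).comp (delta i.succ ε) := by
  apply OrderHom.ext
  funext x
  rw [← Fin.cons_self_tail x]
  refine Eq.trans ?_ (congrArg (star f) (delta_succ_cons i ε _ _).symm)
  rfl

lemma star_comp_delta_zero {m n : ℕ} (f : (Fin m → Fin 2) →o (Fin n → Fin 2)) (ε : Fin 2) :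
    (star f).comp (delta 0 ε) = (delta 0 ε).comp f := by
  apply OrderHom.ext
  funext x
  refine (congrArg (star f) (delta_zero_apply ε x)).trans ?_
  exact (delta_zero_apply ε (f x)).symm

lemma IsCubeMap.star {m n : ℕ} {f : (Fin m → Fin 2) →o (Fin n → Fin 2)} (hf : IsCubeMap f) :
    IsCubeMap (star f) := by
  induction hf with
  | id =>
    rw [star_id]
    exact .id _
  | comp_delta f i ε _ ih =>
    rw [star_delta_comp]
    exact .comp_delta _ _ _ ih

lemma IsCubeMap.le {m n : ℕ} {f : (Fin m → Fin 2) →o (Fin n → Fin 2)} (hf : IsCubeMap f) :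
    m ≤ n := by
  induction hf with
  | id => exact le_rfl
  | comp_delta f i ε _ ih => lia

/-- A map into `𝕀ⁿ⁺¹` that is of the form `δ_1^ε ∘ f` or `id × f`. -/
def IsFaceOrStar : ∀ {m n : ℕ}, ((Fin m → Fin 2) →o (Fin n → Fin 2)) → Prop
  -- The cube `𝕀⁰` has no first coordinate, so nothing is required; in the next case `id × g` cannot
  -- occur, as its source has positive dimension.
  | _, 0, _ => True
  | 0, _ + 1, f => ∃ ε g, IsCubeMap g ∧ f = (delta 0 ε).comp g
  | _ + 1, _ + 1, f => (∃ ε g, IsCubeMap g ∧ f = (delta 0 ε).comp g) ∨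
      ∃ g, IsCubeMap g ∧ f = PrecubicalHomology.star g

lemma isFaceOrStar_of_face {m n : ℕ} (ε : Fin 2) {g : (Fin m → Fin 2) →o (Fin n → Fin 2)}
    (hg : IsCubeMap g) : IsFaceOrStar ((delta 0 ε).comp g) := by
  cases m with
  | zero => exact ⟨ε, g, hg, rfl⟩
  | succ m => exact Or.inl ⟨ε, g, hg, rfl⟩

lemma delta_succ_comp_delta_zero {n : ℕ} (i : Fin (n + 1)) (ε ε' : Fin 2) :
    (delta i.succ ε).comp (delta 0 ε') = (delta 0 ε').comp (delta i ε) := by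
  apply OrderHom.ext
  funext x
  refine (congrArg (delta i.succ ε) (delta_zero_apply ε' x)).trans ?_
  exact (delta_succ_cons i ε ε' x).trans (delta_zero_apply _ _).symm

/-- For `i = 0` the composite is a face by definition. For `i > 0` the map `δ_i` moves past a face
`δ_0` by the cubical identity, and is absorbed into the second factor of `id × g`. -/
lemma IsFaceOrStar.delta_comp {m n : ℕ} {f : (Fin m → Fin 2) →o (Fin n → Fin 2)}
    (hf : IsCubeMap f) (h : IsFaceOrStar f) (i : Fin (n + 1)) (ε : Fin 2) :
    IsFaceOrStar ((delta i ε).comp f) := by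
  have face {m n : ℕ} (ε ε' : Fin 2) (i : Fin (n + 1))
      {g : (Fin m → Fin 2) →o (Fin n → Fin 2)} (hg : IsCubeMap g) :
      IsFaceOrStar ((delta i.succ ε).comp ((delta 0 ε').comp g)) := by
    rw [← OrderHom.comp_assoc, delta_succ_comp_delta_zero, OrderHom.comp_assoc]
    exact isFaceOrStar_of_face _ (.comp_delta _ _ _ hg)
  rcases Fin.eq_zero_or_eq_succ i with rfl | ⟨i, rfl⟩
  · exact isFaceOrStar_of_face ε hf
  · match m, n, f, i, hf, h with
    | 0, _ + 1, _, i, _, ⟨ε', g, hg, rfl⟩ => exact face ε ε' i hg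
    | _ + 1, _ + 1, _, i, _, Or.inl ⟨ε', g, hg, rfl⟩ => exact face ε ε' i hg
    | _ + 1, _ + 1, _, i, _, Or.inr ⟨g, hg, rfl⟩ =>
      exact Or.inr ⟨_, .comp_delta g i ε hg, (star_delta_comp g i ε).symm⟩

lemma IsCubeMap.isFaceOrStar {m n : ℕ} {f : (Fin m → Fin 2) →o (Fin n → Fin 2)}
    (hf : IsCubeMap f) : IsFaceOrStar f := by
  induction hf with
  | id =>
    cases m with
    | zero => trivial
    | succ n => exact Or.inr ⟨OrderHom.id, .id n, (star_id n).symm⟩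
  | comp_delta f i ε hf ih => exact ih.delta_comp hf i ε

end Star

namespace Cube

/-- The morphism `id × g`. -/
def star {m n : ℕ} (g : Cube.mk m ⟶ Cube.mk n) : Cube.mk (m + 1) ⟶ Cube.mk (n + 1) :=
  ⟨PrecubicalHomology.star g.1, g.2.star⟩

variable {m n : ℕ}

@[simp]
lemma δ_zero_comp_star (ε : Fin 2) (g : Cube.mk m ⟶ Cube.mk n) : δ 0 ε ≫ star g = g ≫ δ 0 ε :=
  Subtype.ext (star_comp_delta_zero g.1 ε)

lemma star_δ_comp (i : Fin (m + 1)) (ε : Fin 2) (g : Cube.mk (m + 1) ⟶ Cube.mk n) :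
    star (δ i ε ≫ g) = δ i.succ ε ≫ star g :=
  Subtype.ext (star_comp_delta g.1 i ε)

lemma cases_zero (g : Cube.mk 0 ⟶ Cube.mk (n + 1)) :
    ∃ (ε : Fin 2) (g' : Cube.mk 0 ⟶ Cube.mk n), g = g' ≫ δ 0 ε := by
  obtain ⟨ε, g', h, e⟩ := g.2.isFaceOrStar
  exact ⟨ε, ⟨g', h⟩, Subtype.ext e⟩

lemma cases_succ (g : Cube.mk (m + 1) ⟶ Cube.mk (n + 1)) :
    (∃ (ε : Fin 2) (g' : Cube.mk (m + 1) ⟶ Cube.mk n), g = g' ≫ δ 0 ε) ∨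
      ∃ g' : Cube.mk m ⟶ Cube.mk n, g = star g' := by
  obtain ⟨ε, g', h, e⟩ | ⟨g', h, e⟩ := g.2.isFaceOrStar
  · exact Or.inl ⟨ε, ⟨g', h⟩, Subtype.ext e⟩
  · exact Or.inr ⟨⟨g', h⟩, Subtype.ext e⟩

lemma comp_δ_zero_apply (ε : Fin 2) (g : Cube.mk m ⟶ Cube.mk n) (x : Fin m → Fin 2) :
    (g ≫ δ 0 ε).1 x = (Fin.cons ε (g.1 x) : Fin (n + 1) → Fin 2) :=
  delta_zero_apply ε (g.1 x)

/-- Makes the values of `cubeProj` and `cubeHtpy` independent of the preimage chosen in their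
definitions. -/
lemma comp_δ_zero_inj {ε ε' : Fin 2} {g g' : Cube.mk m ⟶ Cube.mk n}
    (h : g ≫ δ 0 ε = g' ≫ δ 0 ε') : ε = ε' ∧ g = g' := by
  have e (x) : (Fin.cons ε (g.1 x) : Fin (n + 1) → Fin 2) = Fin.cons ε' (g'.1 x) := by
    rw [← comp_δ_zero_apply, ← comp_δ_zero_apply, h]
  refine ⟨(Fin.cons_inj.1 (e 0)).1, Subtype.ext (OrderHom.ext _ _ (funext fun x => ?_))⟩
  exact (Fin.cons_inj.1 (e x)).2

/-- The first coordinate takes both values on the left and is constant on the right. -/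
lemma star_ne_comp_δ_zero (ε : Fin 2) (g : Cube.mk m ⟶ Cube.mk n)
    (g' : Cube.mk (m + 1) ⟶ Cube.mk n) : star g ≠ g' ≫ δ 0 ε := by
  intro h
  have e (a : Fin 2) : a = ε := by
    have := comp_δ_zero_apply ε g' (Fin.cons a 0)
    rw [← h] at this
    exact congrFun this 0
  exact absurd ((e 0).trans (e 1).symm) (by decide)

lemma hom_zero_eq (g g' : Cube.mk 0 ⟶ Cube.mk 0) : g = g' :=
  Subtype.ext (OrderHom.ext _ _ (funext fun _ => Subsingleton.elim _ _))

lemma isEmpty_hom_zero (n : ℕ) : IsEmpty (Cube.mk (n + 1) ⟶ Cube.mk 0) :=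
  ⟨fun g => absurd g.2.le (by simp)⟩

end Cube

/-! ### The contraction of the chains of the standard cube -/

section CubeContraction

variable (M : AddCommGrpCat.{u})

/-- The precubical abelian group `⨁_{𝕀ⁿ → 𝕀ᵐ} M`. -/
abbrev cubeChains (m : ℕ) : PrecubicalAb.{u} := (model (op (Cube.mk m))).obj M

variable {m n : ℕ}

/-- The group of `n`-chains of `𝕀ᵐ`. -/
abbrev cubeCh (m n : ℕ) : AddCommGrpCat.{u} := (cubeChains M m).obj (op (Cube.mk n))

/-- The inclusion of the summand of `g`. -/
def cubeι (g : Cube.mk n ⟶ Cube.mk m) : M ⟶ cubeCh M m n := modelι M g.op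

/-- The morphism with given restrictions to the summands. -/
def cubeDesc {N : AddCommGrpCat.{u}} (f : (Cube.mk n ⟶ Cube.mk m) → (M ⟶ N)) :
    cubeCh M m n ⟶ N :=
  modelDesc fun g => f g.unop

@[simp]
lemma cubeι_desc {N : AddCommGrpCat.{u}} (f : (Cube.mk n ⟶ Cube.mk m) → (M ⟶ N))
    (g : Cube.mk n ⟶ Cube.mk m) : cubeι M g ≫ cubeDesc M f = f g :=
  modelι_desc _ _

variable {M} in
lemma cube_hom_ext {N : AddCommGrpCat.{u}} {a b : cubeCh M m n ⟶ N}
    (h : ∀ g, cubeι M g ≫ a = cubeι M g ≫ b) : a = b :=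
  model_hom_ext fun g => h g.unop

@[simp]
lemma cubeι_faceDiff (g : Cube.mk (n + 1) ⟶ Cube.mk m) (i : Fin (n + 1)) :
    cubeι M g ≫ faceDiff (cubeChains M m) i = cubeι M (δ i 1 ≫ g) - cubeι M (δ i 0 ≫ g) := by
  rw [faceDiff, Preadditive.comp_sub]
  exact congrArg₂ _ (modelι_map _ _ _ _) (modelι_map _ _ _ _)

@[simp]
lemma cubeι_faceDiff_assoc (g : Cube.mk (n + 1) ⟶ Cube.mk m) (i : Fin (n + 1))
    {Z : AddCommGrpCat.{u}} (h : _ ⟶ Z) :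
    cubeι M g ≫ faceDiff (cubeChains M m) i ≫ h =
      (cubeι M (δ i 1 ≫ g) - cubeι M (δ i 0 ≫ g)) ≫ h := by
  rw [reassoc_of% cubeι_faceDiff]

/-- The map induced by `M ⟶ M'`. -/
abbrev cubeMap {M M' : AddCommGrpCat.{u}} (φ : M ⟶ M') (m n : ℕ) : cubeCh M m n ⟶ cubeCh M' m n :=
  ((model (op (Cube.mk m))).map φ).app (op (Cube.mk n))

@[simp]
lemma cubeι_map {M M' : AddCommGrpCat.{u}} (φ : M ⟶ M') (g : Cube.mk n ⟶ Cube.mk m) :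
    cubeι M g ≫ cubeMap φ m n = φ ≫ cubeι M' g :=
  modelι_map_app _ _ _

@[simp]
lemma cubeι_map_assoc {M M' : AddCommGrpCat.{u}} (φ : M ⟶ M') (g : Cube.mk n ⟶ Cube.mk m)
    {Z : AddCommGrpCat.{u}} (h : _ ⟶ Z) :
    cubeι M g ≫ cubeMap φ m n ≫ h =
      φ ≫ cubeι M' g ≫ h := by
  rw [reassoc_of% cubeι_map]

/-- The inclusion of the chains of the face `x₁ = ε`. -/
def cubeInc (ε : Fin 2) (m n : ℕ) : cubeCh M m n ⟶ cubeCh M (m + 1) n :=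
  cubeDesc M fun g => cubeι M (g ≫ δ 0 ε)

@[simp]
lemma cubeι_inc (ε : Fin 2) (g : Cube.mk n ⟶ Cube.mk m) :
    cubeι M g ≫ cubeInc M ε m n = cubeι M (g ≫ δ 0 ε) :=
  cubeι_desc _ _ _

@[simp]
lemma cubeι_inc_assoc (ε : Fin 2) (g : Cube.mk n ⟶ Cube.mk m) {Z : AddCommGrpCat.{u}} (h : _ ⟶ Z) :
    cubeι M g ≫ cubeInc M ε m n ≫ h =
      cubeι M (g ≫ δ 0 ε) ≫ h := by
  rw [reassoc_of% cubeι_inc]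

/-- The map sending a face `g` to `id × g`. -/
def cubeStar (m n : ℕ) : cubeCh M m n ⟶ cubeCh M (m + 1) (n + 1) :=
  cubeDesc M fun g => cubeι M (Cube.star g)

@[simp]
lemma cubeι_star (g : Cube.mk n ⟶ Cube.mk m) :
    cubeι M g ≫ cubeStar M m n = cubeι M (Cube.star g) :=
  cubeι_desc _ _ _

@[simp]
lemma cubeι_star_assoc (g : Cube.mk n ⟶ Cube.mk m) {Z : AddCommGrpCat.{u}} (h : _ ⟶ Z) :
    cubeι M g ≫ cubeStar M m n ≫ h =
      cubeι M (Cube.star g) ≫ h := by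
  rw [reassoc_of% cubeι_star]

/-- The inclusion composes with `δ 0 ε` after a face `g`, while the differential composes before it.
-/
lemma cubeInc_d (ε : Fin 2) (m n : ℕ) :
    cubeInc M ε m (n + 1) ≫ cubicalD (cubeChains M (m + 1)) n =
      cubicalD (cubeChains M m) n ≫ cubeInc M ε m n := by
  simp only [cubicalD, Preadditive.comp_sum, Preadditive.sum_comp]
  refine Finset.sum_congr rfl fun i _ => ?_
  rw [Preadditive.comp_zsmul, Preadditive.zsmul_comp]
  congr 1
  exact cube_hom_ext fun g => by simp [Preadditive.sub_comp]

lemma cubeInc_d_assoc (ε : Fin 2) (m n : ℕ) {Z : AddCommGrpCat.{u}} (h : _ ⟶ Z) :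
    cubeInc M ε m (n + 1) ≫ cubicalD (cubeChains M (m + 1)) n ≫ h =
      cubicalD (cubeChains M m) n ≫ cubeInc M ε m n ≫ h := by
  rw [reassoc_of% cubeInc_d]

lemma cubeStar_d_zero (m : ℕ) :
    cubeStar M m 0 ≫ cubicalD (cubeChains M (m + 1)) 0 =
      cubeInc M 0 m 0 - cubeInc M 1 m 0 := by
  refine cube_hom_ext fun g => ?_
  simp [cubicalD, Preadditive.comp_sub]

/-- The Leibniz rule for a product with an interval: the two faces in the first direction are the
ends, and the other faces are `id ×` faces of `g`. -/
lemma cubeStar_d_succ (m n : ℕ) :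
    cubeStar M m (n + 1) ≫ cubicalD (cubeChains M (m + 1)) (n + 1) =
      cubeInc M 0 m (n + 1) - cubeInc M 1 m (n + 1) -
        cubicalD (cubeChains M m) n ≫ cubeStar M m n := by
  rw [cubicalD, Fin.sum_univ_succ, Preadditive.comp_add, cubicalD, Preadditive.comp_sum,
    Preadditive.sum_comp, sub_eq_add_neg _ (∑ i, _), ← Finset.sum_neg_distrib]
  congr 1
  · refine cube_hom_ext fun g => ?_
    simp [Preadditive.comp_sub]
  · refine Finset.sum_congr rfl fun i _ => ?_
    -- The extra first coordinate shifts the index by one, which produces the minus sign.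
    rw [Preadditive.comp_zsmul, Preadditive.zsmul_comp, Fin.val_succ, pow_succ, mul_neg_one,
      neg_smul]
    congr 2
    exact cube_hom_ext fun g => by simp [Cube.star_δ_comp, Preadditive.sub_comp]

lemma cubeCh_hom_ext_zero {N : AddCommGrpCat.{u}} {a b : cubeCh M (m + 1) 0 ⟶ N}
    (h : ∀ ε, cubeInc M ε m 0 ≫ a = cubeInc M ε m 0 ≫ b) : a = b := by
  refine cube_hom_ext fun g => ?_
  obtain ⟨ε, g, rfl⟩ := Cube.cases_zero g
  simpa using cubeι M g ≫= h ε

/-- Every face of `𝕀ᵐ⁺¹` of positive dimension lies in an end or is `id × g`, so chain identities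
need checking only on these two kinds. -/
lemma cubeCh_hom_ext_succ {N : AddCommGrpCat.{u}} {a b : cubeCh M (m + 1) (n + 1) ⟶ N}
    (h : ∀ ε, cubeInc M ε m (n + 1) ≫ a = cubeInc M ε m (n + 1) ≫ b)
    (h' : cubeStar M m n ≫ a = cubeStar M m n ≫ b) : a = b := by
  refine cube_hom_ext fun g => ?_
  obtain ⟨ε, g, rfl⟩ | ⟨g, rfl⟩ := Cube.cases_succ g
  · simpa using cubeι M g ≫= h ε
  · simpa using cubeι M g ≫= h'

open Classical in
/-- The projection to the chains of `𝕀ᵐ` that kills the faces `id × g`. -/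
def cubeProj (m n : ℕ) : cubeCh M (m + 1) n ⟶ cubeCh M m n :=
  cubeDesc M fun g => if h : ∃ (ε : Fin 2) (g' : Cube.mk n ⟶ Cube.mk m), g = g' ≫ δ 0 ε
    then cubeι M h.choose_spec.choose else 0

@[simp]
lemma cubeInc_proj (ε : Fin 2) (m n : ℕ) : cubeInc M ε m n ≫ cubeProj M m n = 𝟙 _ := by
  refine cube_hom_ext fun g => ?_
  have h : ∃ (ε' : Fin 2) (g' : Cube.mk n ⟶ Cube.mk m), g ≫ δ 0 ε = g' ≫ δ 0 ε' := ⟨ε, g, rfl⟩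
  rw [cubeι_inc_assoc, cubeProj, cubeι_desc, dif_pos h, Category.comp_id,
    ← (Cube.comp_δ_zero_inj h.choose_spec.choose_spec).2]

@[simp]
lemma cubeInc_proj_assoc (ε : Fin 2) (m n : ℕ) {Z : AddCommGrpCat.{u}} (h : _ ⟶ Z) :
    cubeInc M ε m n ≫ cubeProj M m n ≫ h =
      h := by
  rw [reassoc_of% cubeInc_proj]

@[simp]
lemma cubeStar_proj (m n : ℕ) : cubeStar M m n ≫ cubeProj M m (n + 1) = 0 := by
  refine cube_hom_ext fun g => ?_
  rw [cubeι_star_assoc, cubeProj, cubeι_desc, dif_neg, comp_zero]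
  rintro ⟨ε, g', h⟩
  exact Cube.star_ne_comp_δ_zero ε g g' h

@[simp]
lemma cubeStar_proj_assoc (m n : ℕ) {Z : AddCommGrpCat.{u}} (h : _ ⟶ Z) :
    cubeStar M m n ≫ cubeProj M m (n + 1) ≫ h =
      0 := by
  rw [reassoc_of% cubeStar_proj, zero_comp]

open Classical in
/-- The homotopy sending the face `g` of `x₁ = 1` to `- id × g`, and all other faces to zero. -/
def cubeHtpy (m n : ℕ) : cubeCh M (m + 1) n ⟶ cubeCh M (m + 1) (n + 1) :=
  cubeDesc M fun g => if h : ∃ g' : Cube.mk n ⟶ Cube.mk m, g = g' ≫ δ 0 1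
    then - cubeι M (Cube.star h.choose) else 0

@[simp]
lemma cubeInc_one_htpy (m n : ℕ) : cubeInc M 1 m n ≫ cubeHtpy M m n = - cubeStar M m n := by
  refine cube_hom_ext fun g => ?_
  have h : ∃ g' : Cube.mk n ⟶ Cube.mk m, g ≫ δ 0 1 = g' ≫ δ 0 1 := ⟨g, rfl⟩
  rw [cubeι_inc_assoc, cubeHtpy, cubeι_desc, dif_pos h, Preadditive.comp_neg, cubeι_star,
    ← (Cube.comp_δ_zero_inj h.choose_spec).2]

@[simp]
lemma cubeInc_one_htpy_assoc (m n : ℕ) {Z : AddCommGrpCat.{u}} (h : _ ⟶ Z) :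
    cubeInc M 1 m n ≫ cubeHtpy M m n ≫ h =
      (- cubeStar M m n) ≫ h := by
  rw [reassoc_of% cubeInc_one_htpy]

@[simp]
lemma cubeInc_zero_htpy (m n : ℕ) : cubeInc M 0 m n ≫ cubeHtpy M m n = 0 := by
  refine cube_hom_ext fun g => ?_
  rw [cubeι_inc_assoc, cubeHtpy, cubeι_desc, dif_neg, comp_zero]
  rintro ⟨g', h⟩
  exact absurd (Cube.comp_δ_zero_inj h).1 (by decide)

@[simp]
lemma cubeInc_zero_htpy_assoc (m n : ℕ) {Z : AddCommGrpCat.{u}} (h : _ ⟶ Z) :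
    cubeInc M 0 m n ≫ cubeHtpy M m n ≫ h =
      0 := by
  rw [reassoc_of% cubeInc_zero_htpy, zero_comp]

@[simp]
lemma cubeStar_htpy (m n : ℕ) : cubeStar M m n ≫ cubeHtpy M m (n + 1) = 0 := by
  refine cube_hom_ext fun g => ?_
  rw [cubeι_star_assoc, cubeHtpy, cubeι_desc, dif_neg, comp_zero]
  rintro ⟨g', h⟩
  exact Cube.star_ne_comp_δ_zero 1 g g' h

@[simp]
lemma cubeStar_htpy_assoc (m n : ℕ) {Z : AddCommGrpCat.{u}} (h : _ ⟶ Z) :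
    cubeStar M m n ≫ cubeHtpy M m (n + 1) ≫ h =
      0 := by
  rw [reassoc_of% cubeStar_htpy, zero_comp]

/-- The only case to compute is `id × g`: its two ends have the same projection and cancel, and the
remaining boundary terms are killed. -/
lemma cubeProj_d (m n : ℕ) :
    cubeProj M m (n + 1) ≫ cubicalD (cubeChains M m) n =
      cubicalD (cubeChains M (m + 1)) n ≫ cubeProj M m n := by
  refine cubeCh_hom_ext_succ M (fun ε => ?_) ?_
  · rw [cubeInc_proj_assoc, cubeInc_d_assoc, cubeInc_proj, Category.comp_id]
  · rw [cubeStar_proj_assoc]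
    cases n with
    | zero => rw [reassoc_of% (cubeStar_d_zero M m)]; simp [Preadditive.sub_comp]
    | succ n => rw [reassoc_of% (cubeStar_d_succ M m n)]; simp [Preadditive.sub_comp]

lemma cubeProj_d_assoc (m n : ℕ) {Z : AddCommGrpCat.{u}} (h : _ ⟶ Z) :
    cubeProj M m (n + 1) ≫ cubicalD (cubeChains M m) n ≫ h =
      cubicalD (cubeChains M (m + 1)) n ≫ cubeProj M m n ≫ h := by
  rw [reassoc_of% cubeProj_d]

lemma cubeHtpy_zero (m : ℕ) :
    cubeHtpy M m 0 ≫ cubicalD (cubeChains M (m + 1)) 0 + cubeProj M m 0 ≫ cubeInc M 0 m 0 =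
      𝟙 _ := by
  refine cubeCh_hom_ext_zero M fun ε => ?_
  rw [Preadditive.comp_add, cubeInc_proj_assoc]
  match ε with
  | 0 => simp
  | 1 => rw [cubeInc_one_htpy_assoc, Preadditive.neg_comp, cubeStar_d_zero]; simp

/-- `𝕀ᵐ⁺¹` deformation retracts onto `x₁ = 0`. On the end `x₁ = 1`, the boundary of `- id × g`
supplies the difference of the two ends, and its Leibniz term cancels `d ≫ cubeHtpy`. On `id × g`,
only the end `x₁ = 1` of the boundary contributes. -/
lemma cubeHtpy_succ (m n : ℕ) :
    cubeHtpy M m (n + 1) ≫ cubicalD (cubeChains M (m + 1)) (n + 1) +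
      cubicalD (cubeChains M (m + 1)) n ≫ cubeHtpy M m n +
        cubeProj M m (n + 1) ≫ cubeInc M 0 m (n + 1) = 𝟙 _ := by
  refine cubeCh_hom_ext_succ M (fun ε => ?_) ?_
  · rw [Preadditive.comp_add, Preadditive.comp_add, cubeInc_proj_assoc, cubeInc_d_assoc]
    match ε with
    | 0 => simp
    | 1 =>
      rw [cubeInc_one_htpy_assoc, cubeInc_one_htpy, Preadditive.neg_comp, cubeStar_d_succ,
        Preadditive.comp_neg, Category.comp_id]
      abel
  · rw [Preadditive.comp_add, Preadditive.comp_add, cubeStar_proj_assoc, cubeStar_htpy_assoc,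
      add_zero, zero_add, Category.comp_id]
    cases n with
    | zero => rw [reassoc_of% (cubeStar_d_zero M m)]; simp [Preadditive.sub_comp]
    | succ n => rw [reassoc_of% (cubeStar_d_succ M m n)]; simp [Preadditive.sub_comp]

/-- The contraction of the chains of `𝕀ᵐ`. -/
def cubeContr : ∀ m n : ℕ, cubeCh M m n ⟶ cubeCh M m (n + 1)
  | 0, _ => 0
  | m + 1, n => cubeHtpy M m n + cubeProj M m n ≫ cubeContr m n ≫ cubeInc M 0 m (n + 1)

/-- The inclusion of the vertex `0`. -/
def cubeSection : ∀ m : ℕ, M ⟶ cubeCh M m 0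
  | 0 => cubeι M (𝟙 _)
  | m + 1 => cubeSection m ≫ cubeInc M 0 m 0

/-- The augmentation of the chains of `𝕀ᵐ`. -/
def cubeAug (m : ℕ) : cubeCh M m 0 ⟶ M := cubeDesc M fun _ => 𝟙 M

@[simp]
lemma cubeι_aug (g : Cube.mk 0 ⟶ Cube.mk m) : cubeι M g ≫ cubeAug M m = 𝟙 M :=
  cubeι_desc _ _ _

@[simp]
lemma cubeι_aug_assoc (g : Cube.mk 0 ⟶ Cube.mk m) {Z : AddCommGrpCat.{u}} (h : _ ⟶ Z) :
    cubeι M g ≫ cubeAug M m ≫ h =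
      h := by
  rw [reassoc_of% cubeι_aug]

@[simp]
lemma cubeInc_aug (ε : Fin 2) (m : ℕ) : cubeInc M ε m 0 ≫ cubeAug M (m + 1) = cubeAug M m :=
  cube_hom_ext fun g => by simp

@[simp]
lemma cubeSection_aug (m : ℕ) : cubeSection M m ≫ cubeAug M m = 𝟙 M := by
  induction m with
  | zero => simp [cubeSection]
  | succ m ih => simp [cubeSection, ih]

lemma cubeContr_zero (m : ℕ) :
    cubeContr M m 0 ≫ cubicalD (cubeChains M m) 0 + cubeAug M m ≫ cubeSection M m = 𝟙 _ := by
  induction m with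
  | zero =>
    refine cube_hom_ext fun g => ?_
    simp [cubeContr, cubeSection, Cube.hom_zero_eq g (𝟙 _)]
  | succ m ih =>
    have e : cubeAug M (m + 1) = cubeProj M m 0 ≫ cubeAug M m :=
      cubeCh_hom_ext_zero M fun ε => by simp
    rw [cubeContr, cubeSection, Preadditive.add_comp, Category.assoc, Category.assoc, cubeInc_d,
      e, Category.assoc, add_assoc, ← Preadditive.comp_add, ← Category.assoc, ← Category.assoc,
      ← Preadditive.add_comp, ih, Category.id_comp, cubeHtpy_zero]

/-- `𝕀⁰` has no faces of positive dimension. In the inductive step the retraction homotopy is added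
to the contraction of `𝕀ᵐ`, conjugated by the chain maps `cubeProj` and `cubeInc`. -/
lemma cubeContr_succ (m n : ℕ) :
    cubeContr M m (n + 1) ≫ cubicalD (cubeChains M m) (n + 1) +
      cubicalD (cubeChains M m) n ≫ cubeContr M m n = 𝟙 _ := by
  induction m with
  | zero => exact cube_hom_ext fun g => ((Cube.isEmpty_hom_zero n).false g).elim
  | succ m ih =>
    have e : cubeProj M m (n + 1) ≫ (cubeContr M m (n + 1) ≫ cubicalD (cubeChains M m) (n + 1) +
        cubicalD (cubeChains M m) n ≫ cubeContr M m n) ≫ cubeInc M 0 m (n + 1) =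
        cubeProj M m (n + 1) ≫ cubeInc M 0 m (n + 1) := by
      rw [ih, Category.id_comp]
    rw [← cubeHtpy_succ, ← e]
    simp only [cubeContr, Preadditive.add_comp, Preadditive.comp_add, Category.assoc, cubeInc_d,
      cubeProj_d_assoc]
    abel

/-! ### Naturality of the contraction in the coefficient group -/

section Naturality

variable {M} {M' : AddCommGrpCat.{u}} (φ : M ⟶ M')

lemma cubeInc_naturality (ε : Fin 2) (m n : ℕ) :
    cubeMap φ m n ≫ cubeInc M' ε m n = cubeInc M ε m n ≫ cubeMap φ (m + 1) n :=
  cube_hom_ext fun g => by simp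

lemma cubeInc_naturality_assoc (ε : Fin 2) (m n : ℕ) {Z : AddCommGrpCat.{u}} (h : _ ⟶ Z) :
    cubeMap φ m n ≫ cubeInc M' ε m n ≫ h =
      cubeInc M ε m n ≫ cubeMap φ (m + 1) n ≫ h := by
  rw [reassoc_of% cubeInc_naturality]

lemma cubeStar_naturality (m n : ℕ) :
    cubeMap φ m n ≫ cubeStar M' m n = cubeStar M m n ≫ cubeMap φ (m + 1) (n + 1) :=
  cube_hom_ext fun g => by simp

lemma cubeStar_naturality_assoc (m n : ℕ) {Z : AddCommGrpCat.{u}} (h : _ ⟶ Z) :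
    cubeMap φ m n ≫ cubeStar M' m n ≫ h =
      cubeStar M m n ≫ cubeMap φ (m + 1) (n + 1) ≫ h := by
  rw [reassoc_of% cubeStar_naturality]

lemma cubeProj_naturality (m n : ℕ) :
    cubeMap φ (m + 1) n ≫ cubeProj M' m n = cubeProj M m n ≫ cubeMap φ m n := by
  cases n with
  | zero => exact cubeCh_hom_ext_zero M fun ε => by simp [← cubeInc_naturality_assoc]
  | succ n =>
    refine cubeCh_hom_ext_succ M (fun ε => by simp [← cubeInc_naturality_assoc]) ?_
    simp [← cubeStar_naturality_assoc]

lemma cubeProj_naturality_assoc (m n : ℕ) {Z : AddCommGrpCat.{u}} (h : _ ⟶ Z) :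
    cubeMap φ (m + 1) n ≫ cubeProj M' m n ≫ h =
      cubeProj M m n ≫ cubeMap φ m n ≫ h := by
  rw [reassoc_of% cubeProj_naturality]

lemma cubeHtpy_naturality (m n : ℕ) :
    cubeMap φ (m + 1) n ≫ cubeHtpy M' m n = cubeHtpy M m n ≫ cubeMap φ (m + 1) (n + 1) := by
  have h (ε : Fin 2) : cubeInc M ε m n ≫ cubeMap φ (m + 1) n ≫ cubeHtpy M' m n =
      cubeInc M ε m n ≫ cubeHtpy M m n ≫ cubeMap φ (m + 1) (n + 1) := by
    rw [← cubeInc_naturality_assoc]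
    match ε with
    | 0 => simp
    | 1 => simp [cubeStar_naturality]
  cases n with
  | zero => exact cubeCh_hom_ext_zero M h
  | succ n => exact cubeCh_hom_ext_succ M h (by simp [← cubeStar_naturality_assoc])

lemma cubeContr_naturality (m n : ℕ) :
    cubeMap φ m n ≫ cubeContr M' m n = cubeContr M m n ≫ cubeMap φ m (n + 1) := by
  induction m with
  | zero => simp [cubeContr]
  | succ m ih =>
    simp only [cubeContr, Preadditive.comp_add, Preadditive.add_comp, Category.assoc,
      cubeHtpy_naturality, cubeProj_naturality_assoc, reassoc_of% ih, cubeInc_naturality]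

lemma cubeContr_naturality_assoc (m n : ℕ) {Z : AddCommGrpCat.{u}} (h : _ ⟶ Z) :
    cubeMap φ m n ≫ cubeContr M' m n ≫ h =
      cubeContr M m n ≫ cubeMap φ m (n + 1) ≫ h := by
  rw [reassoc_of% cubeContr_naturality]

lemma cubeSection_naturality (m : ℕ) :
    cubeSection M m ≫ cubeMap φ m 0 = φ ≫ cubeSection M' m := by
  induction m with
  | zero => simp [cubeSection]
  | succ m ih => simp only [cubeSection, Category.assoc, ← cubeInc_naturality, reassoc_of% ih]

lemma cubeSection_naturality_assoc (m : ℕ) {Z : AddCommGrpCat.{u}} (h : _ ⟶ Z) :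
    cubeSection M m ≫ cubeMap φ m 0 ≫ h =
      φ ≫ cubeSection M' m ≫ h := by
  rw [reassoc_of% cubeSection_naturality]

end Naturality

end CubeContraction

/-! ### Functors with values in chain complexes -/

section FunctorComplex

universe w₁ w₂

variable {B : Type*} [Category* B] {A : Type w₁} [Category.{w₂} A] [Preadditive A]

/-- A functor to chain complexes, as a chain complex of functors. -/
def functorComplex (K : B ⥤ ChainComplex A ℕ) : ChainComplex (B ⥤ A) ℕ where
  X n := K ⋙ HomologicalComplex.eval _ _ n
  d i j := { app F := (K.obj F).d i j, naturality _ _ a := (K.map a).comm i j }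
  shape i j h := by
    ext F
    exact (K.obj F).shape i j h
  d_comp_d' i j k _ _ := by
    ext F
    exact (K.obj F).d_comp_d i j k

/-- A natural transformation between functors to chain complexes, as a chain map. -/
def functorComplexMap {K K' : B ⥤ ChainComplex A ℕ} (η : K ⟶ K') :
    functorComplex K ⟶ functorComplex K' where
  f n := { app F := (η.app F).f n, naturality _ _ a := congrArg (fun t => t.f n) (η.naturality a) }
  comm' i j _ := by
    ext F
    exact (η.app F).comm i j

/-- The natural transformation given by a chain map. -/
def natTransOfMap {K K' : B ⥤ ChainComplex A ℕ} (φ : functorComplex K ⟶ functorComplex K') :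
    K ⟶ K' where
  app F :=
    { f n := (φ.f n).app F
      comm' i j _ := congrArg (fun t => t.app F) (φ.comm i j) }
  naturality F G a := by
    ext n
    exact (φ.f n).naturality a

/-- The evaluation of a homotopy. -/
def homotopyApp {K K' : B ⥤ ChainComplex A ℕ} {φ ψ : functorComplex K ⟶ functorComplex K'}
    (h : Homotopy φ ψ) (F : B) : Homotopy ((natTransOfMap φ).app F) ((natTransOfMap ψ).app F) :=
  ((evaluation B A).obj F).mapHomotopy h

variable [CategoryWithHomology A]

lemma homologyMap_eq_of_homotopy {K K' : B ⥤ ChainComplex A ℕ} {φ ψ : K ⟶ K'}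
    (h : Homotopy (functorComplexMap φ) (functorComplexMap ψ)) (F : B) (n : ℕ) :
    HomologicalComplex.homologyMap (φ.app F) n = HomologicalComplex.homologyMap (ψ.app F) n :=
  (homotopyApp h F).homologyMap_eq n

lemma isIso_homologyMap_of_homotopyEquiv {K K' : B ⥤ ChainComplex A ℕ}
    (e : HomotopyEquiv (functorComplex K) (functorComplex K')) (F : B) (n : ℕ) :
    IsIso (HomologicalComplex.homologyMap ((natTransOfMap e.hom).app F) n) := by
  refine ⟨HomologicalComplex.homologyMap ((natTransOfMap e.inv).app F) n, ?_, ?_⟩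
  · rw [← HomologicalComplex.homologyMap_comp, ← HomologicalComplex.homologyMap_id]
    exact (homotopyApp e.homotopyHomInvId F).homologyMap_eq n
  · rw [← HomologicalComplex.homologyMap_comp, ← HomologicalComplex.homologyMap_id]
    exact (homotopyApp e.homotopyInvHomId F).homologyMap_eq n

end FunctorComplex

/-! ### Augmentations over the colimit and contractibility on models -/

section ColimResolution

universe w₁ w₂

variable {C : Type u} [Category.{v} C] {A : Type w₁} [Category.{w₂} A] [HasCoproducts.{v} A]
  [HasColimitsOfShape C A]

/-- The colimit of a model. -/
def modelColim (c : C) (M : A) : colimit ((model c).obj M) ≅ M where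
  hom := colimit.desc _
    { pt := M
      ι := { app _ := modelDesc fun _ => 𝟙 M
             naturality _ _ _ := model_hom_ext fun g => by simp } }
  inv := modelι M (𝟙 c) ≫ colimit.ι ((model c).obj M) c
  hom_inv_id := by
    -- The summand of `g` is the image under `g` of the summand of `𝟙 c`, so the two are identified
    -- in the colimit.
    refine colimit.hom_ext fun c' => model_hom_ext fun g => ?_
    rw [colimit.ι_desc_assoc, modelι_desc_assoc, Category.id_comp, Category.comp_id,
      ← colimit.w ((model c).obj M) g, modelι_map_assoc, Category.id_comp]
  inv_hom_id := by simp

@[simp]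
lemma modelι_modelColim (c : C) (M : A) {c' : C} (g : c ⟶ c') :
    modelι M g ≫ colimit.ι ((model c).obj M) c' ≫ (modelColim c M).hom = 𝟙 M := by
  simp [modelColim]

@[simp]
lemma modelι_modelColim_assoc (c : C) (M : A) {c' : C} (g : c ⟶ c') {Z : A} (h : _ ⟶ Z) :
    modelι M g ≫ colimit.ι ((model c).obj M) c' ≫ (modelColim c M).hom ≫ h =
      h := by
  rw [reassoc_of% modelι_modelColim]

lemma modelColim_naturality (c : C) {M M' : A} (φ : M ⟶ M') :
    colimMap ((model c).map φ) ≫ (modelColim c M').hom = (modelColim c M).hom ≫ φ := by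
  refine colimit.hom_ext fun c' => model_hom_ext fun g => ?_
  simp

lemma modelColim_naturality_assoc (c : C) {M M' : A} (φ : M ⟶ M') {Z : A} (h : _ ⟶ Z) :
    colimMap ((model c).map φ) ≫ (modelColim c M').hom ≫ h =
      (modelColim c M).hom ≫ φ ≫ h := by
  rw [reassoc_of% modelColim_naturality]

variable [Preadditive A]

/-- An augmentation over the colimit of a functor to chain complexes. -/
structure ColimAugmentation (K : (C ⥤ A) ⥤ ChainComplex A ℕ) where
  app (F : C ⥤ A) : (K.obj F).X 0 ⟶ colimit F
  naturality {F G : C ⥤ A} (η : F ⟶ G) : (K.map η).f 0 ≫ app G = app F ≫ colimMap η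
  d_comp (F : C ⥤ A) : (K.obj F).d 1 0 ≫ app F = 0

namespace ColimAugmentation

variable {K : (C ⥤ A) ⥤ ChainComplex A ℕ}

/-- The augmentation as a natural transformation. -/
def hom (ε : ColimAugmentation K) : (functorComplex K).X 0 ⟶ colim where
  app F := ε.app F
  naturality _ _ η := ε.naturality η

/-- A functor to chain complexes that is contractible on models, naturally, is a resolution of
the colimit. -/
lemma isModelResolution (ε : ColimAugmentation K)
    (h : ∀ (c : C) (M : A) (n : ℕ),
      (K.obj ((model c).obj M)).X n ⟶ (K.obj ((model c).obj M)).X (n + 1))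
    (h_nat : ∀ (c : C) {M M' : A} (φ : M ⟶ M') (n : ℕ),
      (K.map ((model c).map φ)).f n ≫ h c M' n = h c M n ≫ (K.map ((model c).map φ)).f (n + 1))
    (s : ∀ (c : C) (M : A), M ⟶ (K.obj ((model c).obj M)).X 0)
    (s_nat : ∀ (c : C) {M M' : A} (φ : M ⟶ M'),
      φ ≫ s c M' = s c M ≫ (K.map ((model c).map φ)).f 0)
    (h_succ : ∀ (c : C) (M : A) (n : ℕ),
      h c M (n + 1) ≫ (K.obj ((model c).obj M)).d (n + 2) (n + 1) +
        (K.obj ((model c).obj M)).d (n + 1) n ≫ h c M n = 𝟙 _)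
    (h_zero : ∀ (c : C) (M : A),
      h c M 0 ≫ (K.obj ((model c).obj M)).d 1 0 +
        (ε.app ((model c).obj M) ≫ (modelColim c M).hom) ≫ s c M = 𝟙 _)
    (hs : ∀ (c : C) (M : A), s c M ≫ ε.app ((model c).obj M) ≫ (modelColim c M).hom = 𝟙 _) :
    IsModelResolution (functorComplex K) ε.hom := by
  let H (c : C) (n : ℕ) :
      model c ⋙ (functorComplex K).X n ⟶ model c ⋙ (functorComplex K).X (n + 1) :=
    { app M := h c M n, naturality M M' φ := h_nat c φ n }
  let S (c : C) : model c ⋙ colim ⟶ model c ⋙ (functorComplex K).X 0 :=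
    { app M := (modelColim c M).hom ≫ s c M
      naturality M M' φ := (modelColim_naturality_assoc c φ _).trans
        ((congrArg (_ ≫ ·) (s_nat c φ)).trans (Category.assoc _ _ _).symm) }
  have hs' (c : C) (M : A) : ((modelColim c M).hom ≫ s c M) ≫ ε.app ((model c).obj M) = 𝟙 _ := by
    rw [← cancel_mono (modelColim c M).hom, Category.assoc, Category.assoc, hs, Category.id_comp,
      Category.comp_id]
  -- The splitting `S` of the augmentation serves twice: as the second half of the contraction in
  -- degree 0, and to show that the augmentation is a split epimorphism on models.
  refine ⟨by ext F; exact ε.d_comp F, fun n c => ⟨H c (n + 1), H c n, ?_⟩,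
    fun c => ⟨H c 0, S c, ?_⟩, fun c => ⟨S c, 0, ?_⟩⟩
  · ext M
    exact h_succ c M n
  · ext M
    exact (congrArg _ (Category.assoc _ _ _).symm).trans (h_zero c M)
  · rw [comp_zero, add_zero]
    ext M
    exact hs' c M

end ColimAugmentation

end ColimResolution

/-! ### The bar complex as a resolution of the colimit -/

section BarResolution

open Simplicial

variable {C D : Type u} [Category.{v} C] [Category.{v} D]

/-- The functor `F ↦ C_*(C, F)`. -/
def barComplexFunctor (C : Type u) [Category.{v} C] :
    (C ⥤ AddCommGrpCat.{max u v}) ⥤ ChainComplex AddCommGrpCat.{max u v} ℕ where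
  obj F := barComplex F
  map {F G} η := (AlgebraicTopology.alternatingFaceMapComplex _).map
    (barMap (F := F) (G := G) (𝟭 C) η)
  map_id F := by
    ext n : 1
    refine bar_hom_ext fun c => ?_
    refine (ι_barMap (F := F) (G := F) (𝟭 C) _ _ _).trans ?_
    exact (Category.id_comp _).trans (Category.comp_id _).symm
  map_comp {F G H} η θ := by
    ext n : 1
    refine bar_hom_ext fun c => ?_
    refine (ι_barMap (F := F) (G := H) (𝟭 C) _ (op ⦋n⦌) c).trans ?_
    refine Eq.trans ?_ (((ι_barMap (F := F) (G := G) (𝟭 C) η (op ⦋n⦌) c).symm =≫ _).trans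
      (Category.assoc _ _ _))
    refine (Category.assoc _ _ _).trans (Eq.trans ?_ (Category.assoc _ _ _).symm)
    exact congrArg (η.app _ ≫ ·) (ι_barMap (F := G) (G := H) (𝟭 C) θ (op ⦋n⦌) c).symm

/-- The inclusion of the summand of `c₀ → ⋯ → c_n` in `C_n(C, F)`. -/
def barChainι (F : C ⥤ AddCommGrpCat.{max u v}) {n : ℕ} (c : ComposableArrows C n) :
    F.obj c.left ⟶ ((barComplexFunctor C).obj F).X n :=
  barι F c

lemma barChain_hom_ext {F : C ⥤ AddCommGrpCat.{max u v}} {n : ℕ} {N : AddCommGrpCat.{max u v}}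
    {f g : ((barComplexFunctor C).obj F).X n ⟶ N}
    (h : ∀ c, barChainι F c ≫ f = barChainι F c ≫ g) : f = g :=
  bar_hom_ext h

@[simp]
lemma barChainι_map {F G : C ⥤ AddCommGrpCat.{max u v}} (η : F ⟶ G) {n : ℕ}
    (c : ComposableArrows C n) :
    barChainι F c ≫ ((barComplexFunctor C).map η).f n = η.app c.left ≫ barChainι G c :=
  ι_barMap (F := F) (G := G) (𝟭 C) η (op ⦋n⦌) c

@[simp]
lemma barChainι_map_assoc {F G : C ⥤ AddCommGrpCat.{max u v}} (η : F ⟶ G) {n : ℕ}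
    (c : ComposableArrows C n) {Z : AddCommGrpCat.{max u v}} (h : _ ⟶ Z) :
    barChainι F c ≫ ((barComplexFunctor C).map η).f n ≫ h =
      η.app c.left ≫ barChainι G c ≫ h := by
  rw [reassoc_of% barChainι_map]

lemma barChainι_whisker_aux (S : C ⥤ D) (G : D ⥤ AddCommGrpCat.{max u v}) {n : ℕ}
    (c : ComposableArrows C n) :
    barChainι (S ⋙ G) c ≫ ((AlgebraicTopology.alternatingFaceMapComplex _).map
      (barMap (G := G) S (𝟙 (S ⋙ G)))).f n = barChainι G (c ⋙ S : ComposableArrows D n) :=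
  (ι_barMap (G := G) S (𝟙 (S ⋙ G)) (op ⦋n⦌) c).trans (Category.id_comp _)

/-- The transformation `C_*(C, G ∘ S) ⟶ C_*(D, G)`. -/
def barWhisker (S : C ⥤ D) : (Functor.whiskeringLeft _ _ _).obj S ⋙ barComplexFunctor C ⟶
    barComplexFunctor D where
  app G := (AlgebraicTopology.alternatingFaceMapComplex _).map (barMap (G := G) S (𝟙 (S ⋙ G)))
  naturality F G η := by
    ext n : 1
    refine barChain_hom_ext (F := S ⋙ F) fun c => ?_
    refine (barChainι_map_assoc (Functor.whiskerLeft S η) c _).trans ?_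
    refine (congrArg (_ ≫ ·) (barChainι_whisker_aux S G c)).trans ?_
    refine Eq.trans ?_ (((barChainι_whisker_aux S F c).symm =≫ _).trans (Category.assoc _ _ _))
    exact (barChainι_map η (c ⋙ S : ComposableArrows D n)).symm

lemma barChainι_whisker (S : C ⥤ D) (G : D ⥤ AddCommGrpCat.{max u v}) {n : ℕ}
    (c : ComposableArrows C n) :
    barChainι (S ⋙ G) c ≫ ((barWhisker S).app G).f n =
      barChainι G (c ⋙ S : ComposableArrows D n) :=
  barChainι_whisker_aux S G c

lemma modelProjective_bar (n : ℕ) :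
    ModelProjective ((functorComplex (barComplexFunctor C)).X n) :=
  modelProjective_of_coproduct (fun c : ComposableArrows C n => c.left)
    (fun c F => barChainι F c) (fun c _ _ η => (barChainι_map η c).symm)
    (fun F => ⟨coproductIsCoproduct (fun c : ComposableArrows C n => F.obj (c.obj 0))⟩)

/-- The augmentation `C_0(C, F) ⟶ colim F`. -/
def barChainAug (F : C ⥤ AddCommGrpCat.{max u v}) :
    ((barComplexFunctor C).obj F).X 0 ⟶ colimit F :=
  barDesc fun c => colimit.ι F c.left

@[simp]
lemma barChainι_aug (F : C ⥤ AddCommGrpCat.{max u v}) (c : ComposableArrows C 0) :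
    barChainι F c ≫ barChainAug F = colimit.ι F c.left :=
  barι_desc _ _

@[simp]
lemma barChainι_aug_assoc (F : C ⥤ AddCommGrpCat.{max u v}) (c : ComposableArrows C 0)
    {Z : AddCommGrpCat.{max u v}} (h : _ ⟶ Z) :
    barChainι F c ≫ barChainAug F ≫ h =
      colimit.ι F c.left ≫ h := by
  rw [reassoc_of% barChainι_aug]

/-- The answer does not depend on `i`: in the colimit the two ends of an arrow carry the same
element. Hence the augmentation kills the differential. -/
lemma barChain_δ_aug (F : C ⥤ AddCommGrpCat.{max u v}) (i : Fin 2) :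
    (bar F).δ i ≫ barChainAug F = barDesc fun c => colimit.ι F c.left := by
  refine bar_hom_ext fun c => ?_
  refine ((Category.assoc _ _ _).symm.trans (barι_map F (SimplexCategory.δ i) c =≫ _)).trans ?_
  refine ((Category.assoc _ _ _).trans (congrArg (_ ≫ ·) (barι_desc _ _))).trans ?_
  exact (colimit.w F _).trans (barι_desc (fun c => colimit.ι F c.left) c).symm

/-- The augmentation of the bar complex. -/
def barAugmentation : ColimAugmentation (barComplexFunctor C) where
  app F := barChainAug F
  naturality {F G} η := barChain_hom_ext fun c => by simp
  d_comp F := by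
    have e : ((barComplexFunctor C).obj F).d 1 0 = (bar F).δ 0 - (bar F).δ 1 := by
      refine (AlgebraicTopology.AlternatingFaceMapComplex.obj_d_eq (bar F) 0).trans ?_
      rw [Fin.sum_univ_two]
      simp only [Fin.val_zero, Fin.val_one, pow_zero, pow_one, one_smul, neg_smul]
      exact (sub_eq_add_neg _ _).symm
    rw [e]
    exact (Preadditive.sub_comp _ _ _).trans
      (sub_eq_zero.2 ((barChain_δ_aug F 0).trans (barChain_δ_aug F 1).symm))

lemma barAugmentation_modelColim (c : C) (M : AddCommGrpCat.{max u v}) :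
    barAugmentation.app ((model c).obj M) ≫ (modelColim c M).hom = barAug c M := by
  refine barGen_hom_ext c M fun a e => ?_
  refine Eq.trans ?_ (barGen_aug c M a e).symm
  refine (Category.assoc (modelι M e) (barChainι _ a) _).trans ?_
  exact (congrArg (_ ≫ ·) (barChainι_aug_assoc _ a _)).trans (modelι_modelColim c M e)

lemma barGen_complex_map (c : C) {M M' : AddCommGrpCat.{max u v}} (φ : M ⟶ M') {n : ℕ}
    (a : ComposableArrows C n) (g : c ⟶ a.left) :
    barGen c M a g ≫ ((barComplexFunctor C).map ((model c).map φ)).f n =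
      φ ≫ barGen c M' a g := by
  refine (Category.assoc _ _ _).trans ((congrArg (_ ≫ ·) (barChainι_map _ a)).trans ?_)
  exact modelι_map_app_assoc c φ g _

lemma isModelResolution_bar :
    IsModelResolution (functorComplex (barComplexFunctor C)) barAugmentation.hom := by
  refine barAugmentation.isModelResolution (fun c M n => barExtra c M n) ?_
    (fun c M => barSection c M) ?_ ?_ ?_ ?_
  · intro c M M' φ n
    refine barGen_hom_ext c M fun a g => ?_
    refine ((Category.assoc _ _ _).symm.trans (barGen_complex_map c φ a g =≫ _)).trans ?_
    refine ((Category.assoc _ _ _).trans (congrArg (φ ≫ ·) (barGen_extra c M' a g))).trans ?_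
    refine Eq.trans ?_ ((barGen_extra c M a g =≫ _).symm.trans (Category.assoc _ _ _))
    exact (barGen_complex_map c φ _ _).symm
  · intro c M M' φ
    exact (barGen_complex_map c φ _ _).symm
  · intro c M n
    exact contraction_of_extra (bar ((model c).obj M)) (barExtra c M) (barExtra_δ_zero c M)
      (barExtra_δ_succ c M) n
  · intro c M
    rw [barAugmentation_modelColim]
    exact contraction_zero_of_extra (bar ((model c).obj M)) (barExtra c M) (barExtra_δ_zero c M 0)
      _ _ (barExtra_zero_δ_one c M)
  · intro c M
    rw [barAugmentation_modelColim]
    exact barGen_aug _ _ _ _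

end BarResolution

/-! ### The complex `C_*(X, F)` as a resolution of the colimit -/

section CubeResolution

/-- The functor `F ↦ C_*(X, F)`. -/
def cubeComplexFunctor (X : PrecubicalSet.{u}) :
    HomSystem X ⥤ ChainComplex AddCommGrpCat.{u} ℕ where
  obj F := cubicalComplex (chains F)
  map {F G} η := cubicalComplexMap (chainsMap (F := F) (G := G) (𝟙 X) η)
  map_id F := by
    ext n : 1
    refine Sigma.hom_ext _ _ fun σ => ?_
    refine (ι_chainsMap (F := F) (G := F) (𝟙 X) _ (op (Cube.mk n)) σ).trans ?_
    exact (Category.id_comp _).trans (Category.comp_id _).symm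
  map_comp {F G H} η θ := by
    ext n : 1
    refine Sigma.hom_ext _ _ fun σ => ?_
    refine (ι_chainsMap (F := F) (G := H) (𝟙 X) _ (op (Cube.mk n)) σ).trans ?_
    refine Eq.trans ?_ (((ι_chainsMap (F := F) (G := G) (𝟙 X) η (op (Cube.mk n)) σ).symm =≫ _).trans
      (Category.assoc _ _ _))
    refine (Category.assoc _ _ _).trans (Eq.trans ?_ (Category.assoc _ _ _).symm)
    exact congrArg (η.app _ ≫ ·) (ι_chainsMap (F := G) (G := H) (𝟙 X) θ (op (Cube.mk n)) σ).symm

variable {X Y : PrecubicalSet.{u}}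

/-- The cube `σ`, as an object of `(□₊/X)ᵒᵖ`. -/
abbrev cubeMk {n : ℕ} (σ : X.obj (op (Cube.mk n))) : CubesOp X :=
  X.elementsMk (op (Cube.mk n)) σ

/-- The inclusion of the summand of `σ` in `C_n(X, F)`. -/
def cubeChainι (F : HomSystem X) {n : ℕ} (σ : X.obj (op (Cube.mk n))) :
    F.obj (cubeMk σ) ⟶ ((cubeComplexFunctor X).obj F).X n :=
  Sigma.ι (fun σ : X.obj (op (Cube.mk n)) => F.obj (cubeMk σ)) σ

/-- The morphism with given restrictions to the summands. -/
def cubeChainDesc {F : HomSystem X} {n : ℕ} {N : AddCommGrpCat.{u}}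
    (f : ∀ σ : X.obj (op (Cube.mk n)), F.obj (cubeMk σ) ⟶ N) :
    ((cubeComplexFunctor X).obj F).X n ⟶ N :=
  Sigma.desc f

@[simp]
lemma cubeChainι_desc {F : HomSystem X} {n : ℕ} {N : AddCommGrpCat.{u}}
    (f : ∀ σ : X.obj (op (Cube.mk n)), F.obj (cubeMk σ) ⟶ N) (σ : X.obj (op (Cube.mk n))) :
    cubeChainι F σ ≫ cubeChainDesc f = f σ :=
  Sigma.ι_desc _ _

@[simp]
lemma cubeChainι_desc_assoc {F : HomSystem X} {n : ℕ} {N : AddCommGrpCat.{u}}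
    (f : ∀ σ : X.obj (op (Cube.mk n)), F.obj (cubeMk σ) ⟶ N) (σ : X.obj (op (Cube.mk n)))
    {Z : AddCommGrpCat.{u}} (h : _ ⟶ Z) :
    cubeChainι F σ ≫ cubeChainDesc f ≫ h =
      f σ ≫ h := by
  rw [reassoc_of% cubeChainι_desc]

lemma cubeChain_hom_ext {F : HomSystem X} {n : ℕ} {N : AddCommGrpCat.{u}}
    {f g : ((cubeComplexFunctor X).obj F).X n ⟶ N}
    (h : ∀ σ, cubeChainι F σ ≫ f = cubeChainι F σ ≫ g) : f = g :=
  Sigma.hom_ext _ _ h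

@[simp]
lemma cubeChainι_map {F G : HomSystem X} (η : F ⟶ G) {n : ℕ} (σ : X.obj (op (Cube.mk n))) :
    cubeChainι F σ ≫ ((cubeComplexFunctor X).map η).f n = η.app (cubeMk σ) ≫ cubeChainι G σ :=
  ι_chainsMap (F := F) (G := G) (𝟙 X) η (op (Cube.mk n)) σ

@[simp]
lemma cubeChainι_map_assoc {F G : HomSystem X} (η : F ⟶ G) {n : ℕ} (σ : X.obj (op (Cube.mk n)))
    {Z : AddCommGrpCat.{u}} (h : _ ⟶ Z) :
    cubeChainι F σ ≫ ((cubeComplexFunctor X).map η).f n ≫ h =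
      η.app (cubeMk σ) ≫ cubeChainι G σ ≫ h := by
  rw [reassoc_of% cubeChainι_map]

lemma cubeChainι_d (F : HomSystem X) {n : ℕ} (σ : X.obj (op (Cube.mk (n + 1)))) :
    cubeChainι F σ ≫ ((cubeComplexFunctor X).obj F).d (n + 1) n =
      ∑ i : Fin (n + 1), (-1 : ℤ) ^ ((i : ℕ) + 1) •
        (F.map (CategoryOfElements.homMk (cubeMk σ) (cubeMk (X.map (δ i 1).op σ)) _ rfl) ≫
            cubeChainι F (X.map (δ i 1).op σ) -
          F.map (CategoryOfElements.homMk (cubeMk σ) (cubeMk (X.map (δ i 0).op σ)) _ rfl) ≫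
            cubeChainι F (X.map (δ i 0).op σ)) := by
  refine (congrArg (_ ≫ ·) (cubicalComplex_d (chains F) n)).trans ?_
  refine (Preadditive.comp_sum _ _ _).trans (Finset.sum_congr rfl fun i _ => ?_)
  refine (Preadditive.comp_zsmul _ _ _).trans (congrArg _ ?_)
  exact (Preadditive.comp_sub _ _ _).trans (congrArg₂ _ (ι_chains_map F _ σ) (ι_chains_map F _ σ))

lemma cubeChainι_whisker_aux (f : X ⟶ Y) (G : HomSystem Y) {n : ℕ}
    (σ : X.obj (op (Cube.mk n))) :
    cubeChainι (cubesMap f ⋙ G) σ ≫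
        (cubicalComplexMap (chainsMap (G := G) f (𝟙 (cubesMap f ⋙ G)))).f n =
      cubeChainι G (f.app _ σ) :=
  (ι_chainsMap (G := G) f (𝟙 (cubesMap f ⋙ G)) (op (Cube.mk n)) σ).trans (Category.id_comp _)

/-- The transformation `C_*(X, G ∘ (□₊/f)ᵒᵖ) ⟶ C_*(Y, G)`. -/
def cubeWhisker (f : X ⟶ Y) :
    (Functor.whiskeringLeft _ _ AddCommGrpCat.{u}).obj (cubesMap f) ⋙ cubeComplexFunctor X ⟶
      cubeComplexFunctor Y where
  app G := cubicalComplexMap (chainsMap (G := G) f (𝟙 (cubesMap f ⋙ G)))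
  naturality F G η := by
    ext n : 1
    refine cubeChain_hom_ext (F := cubesMap f ⋙ F) fun σ => ?_
    refine (cubeChainι_map_assoc (Functor.whiskerLeft (cubesMap f) η) σ _).trans ?_
    refine (congrArg (_ ≫ ·) (cubeChainι_whisker_aux f G σ)).trans ?_
    refine Eq.trans ?_ (((cubeChainι_whisker_aux f F σ).symm =≫ _).trans (Category.assoc _ _ _))
    exact (cubeChainι_map η (f.app _ σ)).symm

lemma cubeChainι_whisker (f : X ⟶ Y) (G : HomSystem Y) {n : ℕ} (σ : X.obj (op (Cube.mk n))) :
    cubeChainι (cubesMap f ⋙ G) σ ≫ ((cubeWhisker f).app G).f n = cubeChainι G (f.app _ σ) :=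
  cubeChainι_whisker_aux f G σ

/-- The degree `n` term is `⨁_{σ ∈ X_n} G(f(σ))`, a coproduct of values of `G`. This is what permits
comparing chain maps out of `C_*(X, G ∘ (□₊/f)ᵒᵖ)` over `Y`. -/
lemma modelProjective_whiskered_cube (f : X ⟶ Y) (n : ℕ) :
    ModelProjective ((functorComplex ((Functor.whiskeringLeft _ _ AddCommGrpCat.{u}).obj
      (cubesMap f) ⋙ cubeComplexFunctor X)).X n) :=
  modelProjective_of_coproduct (fun σ : X.obj (op (Cube.mk n)) => cubeMk (f.app _ σ))
    (fun σ G => cubeChainι (cubesMap f ⋙ G) σ)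
    (fun σ _ _ η => (cubeChainι_map (Functor.whiskerLeft (cubesMap f) η) σ).symm)
    (fun G => ⟨coproductIsCoproduct (fun σ : X.obj (op (Cube.mk n)) =>
      (cubesMap f ⋙ G).obj (cubeMk σ))⟩)

lemma modelProjective_cube (n : ℕ) :
    ModelProjective ((functorComplex (cubeComplexFunctor X)).X n) :=
  modelProjective_of_coproduct (fun σ : X.obj (op (Cube.mk n)) => cubeMk σ)
    (fun σ F => cubeChainι F σ) (fun σ _ _ η => (cubeChainι_map η σ).symm)
    (fun F => ⟨coproductIsCoproduct (fun σ : X.obj (op (Cube.mk n)) => F.obj (cubeMk σ))⟩)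

/-- The augmentation of the complex `C_*(X, F)`. -/
def cubeAugmentation : ColimAugmentation (cubeComplexFunctor X) where
  app F := cubeChainDesc fun σ => colimit.ι F (cubeMk σ)
  naturality {F G} η := cubeChain_hom_ext fun σ => by simp
  d_comp F := cubeChain_hom_ext fun σ => by
    rw [← Category.assoc, cubeChainι_d, comp_zero, Preadditive.sum_comp]
    refine Finset.sum_eq_zero fun i _ => ?_
    rw [Preadditive.zsmul_comp, Preadditive.sub_comp, Category.assoc, Category.assoc,
      cubeChainι_desc, cubeChainι_desc, colimit.w, colimit.w, sub_self, smul_zero]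

@[simp]
lemma cubeChainι_augmentation (F : HomSystem X) (σ : X.obj (op (Cube.mk 0))) :
    cubeChainι F σ ≫ cubeAugmentation.app F = colimit.ι F (cubeMk σ) :=
  cubeChainι_desc _ _

@[simp]
lemma cubeChainι_augmentation_assoc (F : HomSystem X) (σ : X.obj (op (Cube.mk 0)))
    {Z : AddCommGrpCat.{u}} (h : _ ⟶ Z) :
    cubeChainι F σ ≫ cubeAugmentation.app F ≫ h =
      colimit.ι F (cubeMk σ) ≫ h := by
  rw [reassoc_of% cubeChainι_augmentation]

/-! ### The contraction on models -/

variable {m : ℕ} (σ : X.obj (op (Cube.mk m))) (M : AddCommGrpCat.{u})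

/-- Handles equalities of cubes such as `X(αβ)(σ) = X(β)(X(α)(σ))`, across which the summands have
different types. -/
lemma modelι_cubeChainι_congr {n : ℕ} {τ τ' : X.obj (op (Cube.mk n))} (h : τ = τ')
    (g : cubeMk σ ⟶ cubeMk τ) (g' : cubeMk σ ⟶ cubeMk τ') (hg : g.1 = g'.1) :
    modelι M g ≫ cubeChainι ((model (cubeMk σ)).obj M) τ =
      modelι M g' ≫ cubeChainι ((model (cubeMk σ)).obj M) τ' := by
  subst h
  obtain rfl : g = g' := Subtype.ext hg
  rfl

/-- The morphism from `C_n(X, -)` of a model to the `n`-chains of the standard cube. -/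
def toCubeCh (n : ℕ) :
    ((cubeComplexFunctor X).obj ((model (cubeMk σ)).obj M)).X n ⟶ cubeCh M m n :=
  cubeChainDesc fun _ => modelDesc fun g => cubeι M g.1.unop

@[simp]
lemma cubeChainι_toCubeCh {n : ℕ} {τ : X.obj (op (Cube.mk n))} (g : cubeMk σ ⟶ cubeMk τ) :
    modelι M g ≫ cubeChainι _ τ ≫ toCubeCh σ M n = cubeι M g.1.unop := by
  simp [toCubeCh]

@[simp]
lemma cubeChainι_toCubeCh_assoc {n : ℕ} {τ : X.obj (op (Cube.mk n))} (g : cubeMk σ ⟶ cubeMk τ)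
    {Z : AddCommGrpCat.{u}} (h : _ ⟶ Z) :
    modelι M g ≫ cubeChainι _ τ ≫ toCubeCh σ M n ≫ h =
      cubeι M g.1.unop ≫ h := by
  rw [reassoc_of% cubeChainι_toCubeCh]

/-- The face of `σ` given by `g`, as a morphism in `(□₊/X)ᵒᵖ`. -/
def toFace {n : ℕ} (g : Cube.mk n ⟶ Cube.mk m) : cubeMk σ ⟶ cubeMk (X.map g.op σ) :=
  CategoryOfElements.homMk _ _ g.op rfl

/-- The morphism from the `n`-chains of the standard cube to `C_n(X, -)` of a model. -/
def ofCubeCh (n : ℕ) :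
    cubeCh M m n ⟶ ((cubeComplexFunctor X).obj ((model (cubeMk σ)).obj M)).X n :=
  cubeDesc M fun g => modelι M (toFace σ g) ≫ cubeChainι _ (X.map g.op σ)

@[simp]
lemma cubeι_ofCubeCh {n : ℕ} (g : Cube.mk n ⟶ Cube.mk m) :
    cubeι M g ≫ ofCubeCh σ M n = modelι M (toFace σ g) ≫ cubeChainι _ (X.map g.op σ) :=
  cubeι_desc _ _ _

@[simp]
lemma cubeι_ofCubeCh_assoc {n : ℕ} (g : Cube.mk n ⟶ Cube.mk m) {Z : AddCommGrpCat.{u}} (h : _ ⟶ Z) :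
    cubeι M g ≫ ofCubeCh σ M n ≫ h =
      modelι M (toFace σ g) ≫ cubeChainι _ (X.map g.op σ) ≫ h := by
  rw [reassoc_of% cubeι_ofCubeCh]

lemma modelChain_hom_ext {n : ℕ} {N : AddCommGrpCat.{u}}
    {a b : ((cubeComplexFunctor X).obj ((model (cubeMk σ)).obj M)).X n ⟶ N}
    (h : ∀ (τ : X.obj (op (Cube.mk n))) (g : cubeMk σ ⟶ cubeMk τ),
      modelι M g ≫ cubeChainι _ τ ≫ a = modelι M g ≫ cubeChainι _ τ ≫ b) : a = b :=
  cubeChain_hom_ext fun τ => model_hom_ext fun g => h τ g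

-- A morphism `σ ⟶ τ` is a face `g` of `𝕀ᵐ` with `X(g)(σ) = τ`, so `g` determines `τ`. This
-- composite alone suffices to transport the contraction of the standard cube.
@[simp]
lemma toCubeCh_ofCubeCh (n : ℕ) : toCubeCh σ M n ≫ ofCubeCh σ M n = 𝟙 _ := by
  refine modelChain_hom_ext σ M fun τ g => ?_
  rw [cubeChainι_toCubeCh_assoc, cubeι_ofCubeCh, Category.comp_id]
  exact modelι_cubeChainι_congr σ M g.2 _ _ rfl

lemma toCubeCh_naturality {M M' : AddCommGrpCat.{u}} (φ : M ⟶ M') (n : ℕ) :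
    ((cubeComplexFunctor X).map ((model (cubeMk σ)).map φ)).f n ≫ toCubeCh σ M' n =
      toCubeCh σ M n ≫ cubeMap φ m n := by
  refine modelChain_hom_ext σ M fun τ g => ?_
  rw [cubeChainι_map_assoc, modelι_map_app_assoc, cubeChainι_toCubeCh,
    cubeChainι_toCubeCh_assoc, cubeι_map]

lemma toCubeCh_naturality_assoc {M M' : AddCommGrpCat.{u}} (φ : M ⟶ M') (n : ℕ)
    {Z : AddCommGrpCat.{u}} (h : _ ⟶ Z) :
    ((cubeComplexFunctor X).map ((model (cubeMk σ)).map φ)).f n ≫ toCubeCh σ M' n ≫ h =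
      toCubeCh σ M n ≫ cubeMap φ m n ≫ h := by
  rw [reassoc_of% toCubeCh_naturality]

lemma ofCubeCh_naturality {M M' : AddCommGrpCat.{u}} (φ : M ⟶ M') (n : ℕ) :
    cubeMap φ m n ≫ ofCubeCh σ M' n =
      ofCubeCh σ M n ≫ ((cubeComplexFunctor X).map ((model (cubeMk σ)).map φ)).f n := by
  refine cube_hom_ext fun g => ?_
  rw [cubeι_map_assoc, cubeι_ofCubeCh, cubeι_ofCubeCh_assoc, cubeChainι_map,
    modelι_map_app_assoc]

lemma ofCubeCh_d (n : ℕ) :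
    ofCubeCh σ M (n + 1) ≫ ((cubeComplexFunctor X).obj ((model (cubeMk σ)).obj M)).d (n + 1) n =
      cubicalD (cubeChains M m) n ≫ ofCubeCh σ M n := by
  refine cube_hom_ext fun g => ?_
  rw [cubeι_ofCubeCh_assoc, cubeChainι_d, cubicalD, Preadditive.sum_comp, Preadditive.comp_sum,
    Preadditive.comp_sum]
  refine Finset.sum_congr rfl fun i _ => ?_
  rw [Preadditive.comp_zsmul, Preadditive.zsmul_comp, Preadditive.comp_zsmul]
  congr 1
  rw [cubeι_faceDiff_assoc, Preadditive.sub_comp, Preadditive.comp_sub, cubeι_ofCubeCh,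
    cubeι_ofCubeCh, modelι_map_assoc, modelι_map_assoc]
  congr 1
  · exact modelι_cubeChainι_congr σ M (by simp) _ _ rfl
  · exact modelι_cubeChainι_congr σ M (by simp) _ _ rfl

lemma toCubeCh_d (n : ℕ) :
    toCubeCh σ M (n + 1) ≫ cubicalD (cubeChains M m) n =
      ((cubeComplexFunctor X).obj ((model (cubeMk σ)).obj M)).d (n + 1) n ≫ toCubeCh σ M n := by
  refine modelChain_hom_ext σ M fun τ g => ?_
  rw [cubeChainι_toCubeCh_assoc, reassoc_of% (cubeChainι_d _ τ), cubicalD, Preadditive.sum_comp,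
    Preadditive.comp_sum, Preadditive.comp_sum]
  refine Finset.sum_congr rfl fun i _ => ?_
  rw [Preadditive.comp_zsmul, Preadditive.zsmul_comp, Preadditive.comp_zsmul, cubeι_faceDiff,
    Preadditive.sub_comp, Preadditive.comp_sub, Category.assoc, Category.assoc,
    modelι_map_assoc, modelι_map_assoc, cubeChainι_toCubeCh, cubeChainι_toCubeCh]
  rfl

lemma toCubeCh_d_assoc (n : ℕ) {Z : AddCommGrpCat.{u}} (h : _ ⟶ Z) :
    toCubeCh σ M (n + 1) ≫ cubicalD (cubeChains M m) n ≫ h =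
      ((cubeComplexFunctor X).obj ((model (cubeMk σ)).obj M)).d (n + 1) n ≫ toCubeCh σ M n ≫ h := by
  rw [reassoc_of% toCubeCh_d]

lemma cubeAugmentation_modelColim :
    cubeAugmentation.app ((model (cubeMk σ)).obj M) ≫ (modelColim (cubeMk σ) M).hom =
      toCubeCh σ M 0 ≫ cubeAug M m := by
  refine modelChain_hom_ext σ M fun τ g => ?_
  rw [cubeChainι_augmentation_assoc, modelι_modelColim, cubeChainι_toCubeCh_assoc, cubeι_aug]

lemma ofCubeCh_augmentation :
    ofCubeCh σ M 0 ≫ cubeAugmentation.app ((model (cubeMk σ)).obj M) ≫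
      (modelColim (cubeMk σ) M).hom = cubeAug M m := by
  refine cube_hom_ext fun g => ?_
  rw [cubeι_ofCubeCh_assoc, cubeChainι_augmentation_assoc, modelι_modelColim, cubeι_aug]

lemma toCubeCh_contr_ofCubeCh (n : ℕ) :
    (toCubeCh σ M (n + 1) ≫ cubeContr M m (n + 1) ≫ ofCubeCh σ M (n + 2)) ≫
        ((cubeComplexFunctor X).obj ((model (cubeMk σ)).obj M)).d (n + 2) (n + 1) +
      ((cubeComplexFunctor X).obj ((model (cubeMk σ)).obj M)).d (n + 1) n ≫
        toCubeCh σ M n ≫ cubeContr M m n ≫ ofCubeCh σ M (n + 1) = 𝟙 _ := by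
  have e := toCubeCh σ M (n + 1) ≫= (cubeContr_succ M m n =≫ ofCubeCh σ M (n + 1))
  rw [Category.id_comp, toCubeCh_ofCubeCh] at e
  rw [← e, Category.assoc, Category.assoc, ofCubeCh_d, ← toCubeCh_d_assoc, Preadditive.add_comp,
    Preadditive.comp_add, Category.assoc, Category.assoc]

lemma toCubeCh_contr_ofCubeCh_zero :
    (toCubeCh σ M 0 ≫ cubeContr M m 0 ≫ ofCubeCh σ M 1) ≫
        ((cubeComplexFunctor X).obj ((model (cubeMk σ)).obj M)).d 1 0 +
      (cubeAugmentation.app ((model (cubeMk σ)).obj M) ≫ (modelColim (cubeMk σ) M).hom) ≫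
        cubeSection M m ≫ ofCubeCh σ M 0 = 𝟙 _ := by
  have e := toCubeCh σ M 0 ≫= (cubeContr_zero M m =≫ ofCubeCh σ M 0)
  rw [Category.id_comp, toCubeCh_ofCubeCh] at e
  rw [← e, Category.assoc, Category.assoc, ofCubeCh_d, cubeAugmentation_modelColim,
    Preadditive.add_comp, Preadditive.comp_add, Category.assoc, Category.assoc, Category.assoc]

lemma isModelResolution_cube (X : PrecubicalSet.{u}) :
    IsModelResolution (functorComplex (cubeComplexFunctor X)) (cubeAugmentation (X := X)).hom := by
  refine (cubeAugmentation (X := X)).isModelResolution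
    (fun c M n => toCubeCh (m := c.1.unop.dim) c.2 M n ≫ cubeContr M c.1.unop.dim n ≫
      ofCubeCh (m := c.1.unop.dim) c.2 M (n + 1)) ?_
    (fun c M => cubeSection M c.1.unop.dim ≫ ofCubeCh (m := c.1.unop.dim) c.2 M 0) ?_ ?_ ?_ ?_
  -- Once the object is taken apart it is `cubeMk σ`, the form in which the contraction identities
  -- are stated.
  all_goals rintro ⟨⟨⟨m⟩⟩, σ⟩
  · intro M M' φ n
    exact (by simp only [toCubeCh_naturality_assoc, cubeContr_naturality_assoc, ofCubeCh_naturality,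
        Category.assoc] :
      ((cubeComplexFunctor X).map ((model (cubeMk σ)).map φ)).f n ≫ toCubeCh σ M' n ≫
        cubeContr M' m n ≫ ofCubeCh σ M' (n + 1) =
      (toCubeCh σ M n ≫ cubeContr M m n ≫ ofCubeCh σ M (n + 1)) ≫
        ((cubeComplexFunctor X).map ((model (cubeMk σ)).map φ)).f (n + 1))
  · intro M M' φ
    exact (by rw [← cubeSection_naturality_assoc, ofCubeCh_naturality, Category.assoc] :
      φ ≫ cubeSection M' m ≫ ofCubeCh σ M' 0 = (cubeSection M m ≫ ofCubeCh σ M 0) ≫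
        ((cubeComplexFunctor X).map ((model (cubeMk σ)).map φ)).f 0)
  · intro M n
    exact toCubeCh_contr_ofCubeCh σ M n
  · intro M
    exact toCubeCh_contr_ofCubeCh_zero σ M
  · intro M
    exact (by rw [Category.assoc, ofCubeCh_augmentation, cubeSection_aug] :
      (cubeSection M m ≫ ofCubeCh σ M 0) ≫ cubeAugmentation.app ((model (cubeMk σ)).obj M) ≫
      (modelColim (cubeMk σ) M).hom = 𝟙 M)

end CubeResolution

/-! ### The comparison of the two complexes -/

section Comparison

variable (X : PrecubicalSet.{u})

lemma exists_comparison :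
    ∃ e : HomotopyEquiv (functorComplex (cubeComplexFunctor X))
      (functorComplex (barComplexFunctor (CubesOp X))),
      e.hom.f 0 ≫ barAugmentation.hom = (cubeAugmentation (X := X)).hom :=
  (isModelResolution_cube X).exists_homotopyEquiv modelProjective_cube modelProjective_bar
    isModelResolution_bar

/-- The comparison map `C_*(X, F) ⟶ C_*((□₊/X)ᵒᵖ, F)`. -/
def comparison : cubeComplexFunctor X ⟶ barComplexFunctor (CubesOp X) :=
  natTransOfMap (exists_comparison X).choose.hom

/-- The isomorphism `H_n(X, F) ≅ colim_n F`. -/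
def comparisonIso (F : HomSystem X) (n : ℕ) : homology F n ≅ colimN F n :=
  @asIso _ _ _ _ (HomologicalComplex.homologyMap ((comparison X).app F) n)
    (isIso_homologyMap_of_homotopyEquiv (exists_comparison X).choose F n)

lemma comparison_augmentation (F : HomSystem X) :
    ((comparison X).app F).f 0 ≫ barAugmentation.app F = cubeAugmentation.app F :=
  congrArg (fun t => t.app F) (exists_comparison X).choose_spec

variable {X} {Y : PrecubicalSet.{u}}

lemma cubeWhisker_augmentation (f : X ⟶ Y) (G : HomSystem Y) :
    ((cubeWhisker f).app G).f 0 ≫ cubeAugmentation.app G =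
      cubeAugmentation.app (cubesMap f ⋙ G) ≫ colimit.pre G (cubesMap f) := by
  refine cubeChain_hom_ext (F := cubesMap f ⋙ G) fun σ => ?_
  refine (Category.assoc _ _ _).symm.trans ((cubeChainι_whisker f G σ =≫ _).trans ?_)
  rw [cubeChainι_augmentation, cubeChainι_augmentation_assoc]
  exact (colimit.ι_pre G (cubesMap f) (cubeMk σ)).symm

lemma barWhisker_augmentation (f : X ⟶ Y) (G : HomSystem Y) :
    ((barWhisker (cubesMap f)).app G).f 0 ≫ barAugmentation.app G =
      barAugmentation.app (cubesMap f ⋙ G) ≫ colimit.pre G (cubesMap f) := by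
  refine barChain_hom_ext (F := cubesMap f ⋙ G) fun c => ?_
  refine (Category.assoc _ _ _).symm.trans ((barChainι_whisker (cubesMap f) G c =≫ _).trans ?_)
  refine (barChainι_aug G _).trans ?_
  refine Eq.trans ?_ (barChainι_aug_assoc (cubesMap f ⋙ G) c _).symm
  exact (colimit.ι_pre G (cubesMap f) c.left).symm

/-- Both composites cover the canonical map `colimit.pre` of colimits, so uniqueness of lifts up to
homotopy applies; equality holds only on homology. -/
lemma comparison_naturality (f : X ⟶ Y) (G : HomSystem Y) (n : ℕ) :
    HomologicalComplex.homologyMap ((cubeWhisker f).app G) n ≫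
        HomologicalComplex.homologyMap ((comparison Y).app G) n =
      HomologicalComplex.homologyMap ((comparison X).app (cubesMap f ⋙ G)) n ≫
        HomologicalComplex.homologyMap ((barWhisker (cubesMap f)).app G) n := by
  let φ : (Functor.whiskeringLeft _ _ AddCommGrpCat.{u}).obj (cubesMap f) ⋙ cubeComplexFunctor X ⟶
      barComplexFunctor (CubesOp Y) := cubeWhisker f ≫ comparison Y
  let ψ : (Functor.whiskeringLeft _ _ AddCommGrpCat.{u}).obj (cubesMap f) ⋙ cubeComplexFunctor X ⟶
      barComplexFunctor (CubesOp Y) :=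
    Functor.whiskerLeft _ (comparison X) ≫ barWhisker (cubesMap f)
  -- Agreement after augmentation, for all `G` at once, since the homotopy must be found among
  -- functors of `G`.
  have h : (functorComplexMap φ).f 0 ≫ barAugmentation.hom =
      (functorComplexMap ψ).f 0 ≫ barAugmentation.hom := by
    ext G : 2
    change (((cubeWhisker f).app G).f 0 ≫ ((comparison Y).app G).f 0) ≫ barAugmentation.app G =
      (((comparison X).app (cubesMap f ⋙ G)).f 0 ≫ ((barWhisker (cubesMap f)).app G).f 0) ≫
        barAugmentation.app G
    rw [Category.assoc, Category.assoc, comparison_augmentation, cubeWhisker_augmentation]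
    refine Eq.trans ?_ (congrArg (_ ≫ ·) (barWhisker_augmentation f G)).symm
    rw [← Category.assoc, comparison_augmentation]
  obtain ⟨H⟩ := isModelResolution_bar.homotopy (modelProjective_whiskered_cube f) h
  have := homologyMap_eq_of_homotopy H G n
  exact ((HomologicalComplex.homologyMap_comp _ _ n).symm.trans this).trans
    (HomologicalComplex.homologyMap_comp _ _ n)

end Comparison

end PrecubicalHomology

end


theorem mainTheorem3 (n : ℕ) :
    Nonempty (PrecubicalHomology.HS.homologyFunctor.{u} n ≅
      PrecubicalHomology.HS.colimFunctor.{u} n) := by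
  refine ⟨NatIso.ofComponents (fun A => PrecubicalHomology.comparisonIso A.X A.F n) ?_⟩
  rintro ⟨X, F⟩ ⟨Y, G⟩ ⟨f, h⟩
  change X ⟶ Y at f
  change PrecubicalHomology.cubesMap f ⋙ G = F at h
  -- With `F` replaced by `G ∘ (□₊/f)ᵒᵖ`, the coefficient transformation becomes the identity, and
  -- the induced maps are those of `cubeWhisker` and `barWhisker`.
  subst h
  exact PrecubicalHomology.comparison_naturality f G n
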